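/- Let $N$ be a simply connected Lie group of dimension $5$ whose Lie algebra $\mathfrak n$ is two-step nilpotent, i.e. $[\mathfrak n,\mathfrak n]\neq 0$ and $[\mathfrak n,[\mathfrak n,\mathfrak n]]=0$. Let $g$ be a left-invariant Riemannian metric on $N$, let $\nabla$ be its Levi-Civita connection, and let $\mathfrak h$ be the center of $\mathfrak n$. Elements of $\mathfrak n$ are identified with left-invariant vector fields on $N$. A vector field $X$ on $N$ is called *affine* if its local one-parameter group consists of local affine transformations of $(N,\nabla)$, that is, of diffeomorphisms $f$ between open sets with $f_*(\nabla_Y Z)=\nabla_{f_*Y}(f_*Z)$ for all smooth vector fields $Y,Z$. It is called *projective* if its local one-parameter group consists of local projective transformations, that is, of diffeomorphisms $f$ between open sets such that for every geodesic $\gamma$ in the domain of $f$ the curve $f\circ\gamma$ is a reparametrization of a geodesic. **Theorem.** Every left-invariant projective vector field $X\in\mathfrak n$ is affine. Moreover, a left-invariant vector field $X\in\mathfrak n$ is affine if and only if $X\in\mathfrak h$. -/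

import Mathlib

open Set Bundle
open scoped Manifold ContDiff Topology

noncomputable section

namespace GeometricFields

/-- A smooth real Lie group has enough regularity for Mathlib's Lie algebra structure on its
tangent space at the identity. -/
instance lieGroup_minSmoothness {E : Type*} [NormedAddCommGroup E] [NormedSpace ℝ E]
    {H : Type*} [TopologicalSpace H] {I : ModelWithCorners ℝ E H}
    {G : Type*} [TopologicalSpace G] [ChartedSpace H G] [Group G] [LieGroup I ∞ G] :
    LieGroup I (minSmoothness ℝ 3) G := by
  rw [minSmoothness_of_isRCLikeNormedField]
  infer_instance

/-- A Lie algebra `L` is two-step nilpotent if `[L, L] ≠ 0` and `[L, [L, L]] = 0`. -/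
def IsTwoStepNilpotent (L : Type*) [LieRing L] : Prop :=
  (∃ u v : L, ⁅u, v⁆ ≠ 0) ∧ ∀ u v w : L, ⁅u, ⁅v, w⁆⁆ = 0

section Manifold

variable {E : Type*} [NormedAddCommGroup E] [NormedSpace ℝ E]
  {H : Type*} [TopologicalSpace H] {I : ModelWithCorners ℝ E H}
  {M : Type*} [TopologicalSpace M] [ChartedSpace H M]

/-- `φ` is a local one-parameter group (local flow) of the vector field `X`, defined on the open
set `U` for times in `(-ε, ε)`: it is smooth, `φ 0` is the identity on `U`, and every
`t ↦ φ t p`, `p ∈ U`, is an integral curve of `X`. -/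
structure IsLocalFlow (X : Π x : M, TangentSpace I x) (U : Set M) (ε : ℝ) (φ : ℝ → M → M) :
    Prop where
  isOpen : IsOpen U
  pos : 0 < ε
  contMDiffOn : ContMDiffOn (𝓘(ℝ, ℝ).prod I) I ∞ (fun q : ℝ × M ↦ φ q.1 q.2) (Ioo (-ε) ε ×ˢ U)
  zero : ∀ p ∈ U, φ 0 p = p
  integral : ∀ p ∈ U, IsMIntegralCurveOn (fun t ↦ φ t p) X (Ioo (-ε) ε)

/-- The velocity vector of a curve. -/
def velocity (γ : ℝ → M) (t : ℝ) : TangentSpace I (γ t) :=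
  mfderiv 𝓘(ℝ, ℝ) I γ t (1 : ℝ)

variable [IsManifold I 1 M]

/-- The covariant derivative `D W / dt` at time `t` of a vector field `W` along the curve `γ`.
In the coordinate frame `(∂ᵢ)` of the tangent bundle around `γ t`, where `W s = ∑ᵢ wⁱ(s) ∂ᵢ`, it is
`∑ᵢ (wⁱ)'(t) ∂ᵢ + ∇_{γ'(t)} (∑ᵢ wⁱ(t) ∂ᵢ)`: the first summand differentiates the components, the
second one is the covariant derivative of the field with constant components `wⁱ(t)`. -/
def covDerivAlong (cov : CovariantDerivative I E (TangentSpace I : M → Type _))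
    (γ : ℝ → M) (W : Π t : ℝ, TangentSpace I (γ t)) (t : ℝ) : TangentSpace I (γ t) :=
  let e := trivializationAt E (TangentSpace I : M → Type _) (γ t)
  let w : ℝ → E := fun s ↦ (e ⟨γ s, W s⟩).2
  e.symm (γ t) (deriv w t) + cov (fun x ↦ e.symm x (w t)) (γ t) (velocity γ t)

/-- `γ` is a geodesic of `∇` on `J`: it is smooth there and `D γ' / dt = 0`. -/
def IsGeodesicOn (cov : CovariantDerivative I E (TangentSpace I : M → Type _))
    (γ : ℝ → M) (J : Set ℝ) : Prop :=
  ContMDiffOn 𝓘(ℝ, ℝ) I ∞ γ J ∧ ∀ t ∈ J, covDerivAlong cov γ (velocity γ) t = 0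

/-- On the open interval `J` the curve `c` is a reparametrization `β ∘ h` of a geodesic `β`, where
`h` is a smooth change of parameter with nowhere vanishing derivative. -/
def IsReparametrizedGeodesicOn (cov : CovariantDerivative I E (TangentSpace I : M → Type _))
    (c : ℝ → M) (J : Set ℝ) : Prop :=
  ∃ (β : ℝ → M) (h : ℝ → ℝ), ContDiffOn ℝ ∞ h J ∧ (∀ t ∈ J, deriv h t ≠ 0) ∧
    IsGeodesicOn cov β (h '' J) ∧ ∀ t ∈ J, c t = β (h t)

/-- `f` restricts to a diffeomorphism of the open set `U` onto the open set `f '' U`. -/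
def IsLocalTransformation (I : ModelWithCorners ℝ E H) [IsManifold I 1 M]
    (U : Set M) (f : M → M) : Prop :=
  IsOpen U ∧ IsLocalDiffeomorphOn I I ∞ f U ∧ InjOn f U

/-- `f` is a local affine transformation on `U`: a diffeomorphism of `U` onto its image with
`f_* (∇_Y Z) = ∇_{f_* Y} (f_* Z)`. The fields `Z` (near `p`) and `Z'` (near `f p`) are smooth and
`f`-related, that is `Z' = f_* Z`, and `v` is the value of `Y` at `p`. -/
def IsLocalAffineMap (cov : CovariantDerivative I E (TangentSpace I : M → Type _))
    (U : Set M) (f : M → M) : Prop :=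
  IsLocalTransformation I U f ∧
    ∀ p ∈ U, ∀ Z Z' : Π x : M, TangentSpace I x,
      ContMDiffAt I I.tangent ∞ (fun x ↦ (⟨x, Z x⟩ : TangentBundle I M)) p →
      ContMDiffAt I I.tangent ∞ (fun x ↦ (⟨x, Z' x⟩ : TangentBundle I M)) (f p) →
      (∀ᶠ x in 𝓝 p, mfderiv I I f x (Z x) = Z' (f x)) →
      ∀ v : TangentSpace I p,
        mfderiv I I f p (cov Z p v) = cov Z' (f p) (mfderiv I I f p v)

/-- `f` is a local projective transformation on `U`: a diffeomorphism of `U` onto its image that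
maps every geodesic in `U` to a reparametrization of a geodesic. -/
def IsLocalProjectiveMap (cov : CovariantDerivative I E (TangentSpace I : M → Type _))
    (U : Set M) (f : M → M) : Prop :=
  IsLocalTransformation I U f ∧
    ∀ (J : Set ℝ) (γ : ℝ → M), IsOpen J → J.OrdConnected → MapsTo γ J U →
      IsGeodesicOn cov γ J → IsReparametrizedGeodesicOn cov (f ∘ γ) J

end Manifold

section Riemannian

variable {E : Type*} [NormedAddCommGroup E] [NormedSpace ℝ E] [FiniteDimensional ℝ E]
  [CompleteSpace E]
  {H : Type*} [TopologicalSpace H] {I : ModelWithCorners ℝ E H}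
  {M : Type*} [TopologicalSpace M] [ChartedSpace H M] [IsManifold I ∞ M]

/-- `∇` is the Levi-Civita connection of the Riemannian metric `g`: it is torsion-free and
compatible with the metric, `v (g(Y, Z)) = g(∇_v Y, Z) + g(Y, ∇_v Z)`. These conditions determine
`∇` on all differentiable vector fields. -/
def IsLeviCivita (g : ContMDiffRiemannianMetric I ∞ E (fun x : M ↦ TangentSpace I x))
    (cov : CovariantDerivative I E (TangentSpace I : M → Type _)) : Prop :=
  cov.torsion = 0 ∧
    ∀ (x : M) (Y Z : Π x : M, TangentSpace I x),
      MDifferentiableAt I I.tangent (fun x ↦ (⟨x, Y x⟩ : TangentBundle I M)) x →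
      MDifferentiableAt I I.tangent (fun x ↦ (⟨x, Z x⟩ : TangentBundle I M)) x →
      ∀ v : TangentSpace I x,
        mfderiv I 𝓘(ℝ, ℝ) (fun y ↦ g.inner y (Y y) (Z y)) x v =
          g.inner x (cov Y x v) (Z x) + g.inner x (Y x) (cov Z x v)

/-- The vector field `X` on the Riemannian manifold `(M, g)` is affine: its local one-parameter
group consists of local affine transformations for the Levi-Civita connection of `g`. -/
def IsAffineField (g : ContMDiffRiemannianMetric I ∞ E (fun x : M ↦ TangentSpace I x))
    (X : Π x : M, TangentSpace I x) : Prop :=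
  ∃ cov : CovariantDerivative I E (TangentSpace I : M → Type _), IsLeviCivita g cov ∧
    ∀ (U : Set M) (ε : ℝ) (φ : ℝ → M → M), IsLocalFlow X U ε φ →
      ∀ t ∈ Ioo (-ε) ε, IsLocalAffineMap cov U (φ t)

/-- The vector field `X` on the Riemannian manifold `(M, g)` is projective: its local one-parameter
group consists of local projective transformations for the Levi-Civita connection of `g`. -/
def IsProjectiveField (g : ContMDiffRiemannianMetric I ∞ E (fun x : M ↦ TangentSpace I x))
    (X : Π x : M, TangentSpace I x) : Prop :=
  ∃ cov : CovariantDerivative I E (TangentSpace I : M → Type _), IsLeviCivita g cov ∧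
    ∀ (U : Set M) (ε : ℝ) (φ : ℝ → M → M), IsLocalFlow X U ε φ →
      ∀ t ∈ Ioo (-ε) ε, IsLocalProjectiveMap cov U (φ t)

end Riemannian

/-- A Riemannian metric on a Lie group is left-invariant if all left translations are isometries. -/
def IsLeftInvariantMetric {E : Type*} [NormedAddCommGroup E] [NormedSpace ℝ E]
    {H : Type*} [TopologicalSpace H] {I : ModelWithCorners ℝ E H}
    {G : Type*} [TopologicalSpace G] [ChartedSpace H G] [Group G] [IsManifold I ∞ G]
    (g : ContMDiffRiemannianMetric I ∞ E (fun x : G ↦ TangentSpace I x)) : Prop :=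
  ∀ (a x : G) (u v : TangentSpace I x),
    g.inner (a * x) (mfderiv I I (fun y ↦ a * y) x u) (mfderiv I I (fun y ↦ a * y) x v) =
      g.inner x u v

end GeometricFields

end

/-!
The argument works on any Lie group `G` with a left-invariant metric whose Lie algebra `𝔤` satisfies
`[𝔤, [𝔤, 𝔤]] = 0`. Tangent vectors are read in the left trivialization (`leftFrame`, `leftCoord`).
The Levi-Civita connection is then `∇_w Z = dz(w) + Γ(w, z)`, where `z` are the left coordinates of
`Z` and `Γ` is the bilinear product given by Koszul's formula
(`exists_isLeviCivita_leftInvariantConnection`).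

A local flow of a left-invariant field `X` is the right translation by the integral curve `c` of `X`
through the identity, by uniqueness of integral curves (`IsLocalFlow.exists_eq_mul_right`,
`isLocalFlow_mul_right`). Right translation by `a` sends the left-invariant field `v` to the
left-invariant field `Ad a⁻¹ v`, and `Ad (c t)⁻¹ v` has derivative `-[X, Ad (c t)⁻¹ v]`
(`hasDerivAt_adInv`); the latter comes down to left-invariant and right-invariant fields commuting,
which in a chart is the symmetry of the second derivative of the multiplication.

If `X` is central, `Ad (c t)` is the identity, so the flow preserves left coordinates and hence
the connection: `X` is affine (`isAffineField_of_lieBilin_eq_zero`).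

Conversely let `v` be orthogonal to the center. Koszul's formula `⟨∇_v v, u⟩ = -⟨v, [v, u]⟩` shows
`∇_v v = 0`, since brackets are central. If `X` is affine, the image `w = Ad (c t)⁻¹ v` of `v` under
the flow also satisfies `∇_w w = 0`. If `X` is projective, the integral curves of `w` are
reparametrized geodesics, so that `∇_w w` is a multiple of `w`; it is orthogonal to `w`
by Koszul's formula, so it again vanishes. In both cases `⟨w, [w, X]⟩ = 0` for all `t`, and
differentiating at `t = 0` gives `|[X, v]|² = 0`, the other term being a double bracket. Thus `X`
commutes with the orthogonal complement of the center, hence with everything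
(`lieBilin_eq_zero_of_adInv`).
-/

namespace GeometricFields

/-! ### Left and right translations on the tangent bundle -/

section LeftTrivialization

variable {E : Type*} [NormedAddCommGroup E] [NormedSpace ℝ E]
  {H : Type*} [TopologicalSpace H] {I : ModelWithCorners ℝ E H}
  {G : Type*} [TopologicalSpace G] [ChartedSpace H G] [Group G]

/-- The differential at the identity of left translation by `x`. Its source, the Lie algebra, is
written as the model space `E`, which carries the norm needed to differentiate functions valued in
the Lie algebra. -/
noncomputable def leftFrame (I : ModelWithCorners ℝ E H) (x : G) : E →L[ℝ] TangentSpace I x :=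
  (mfderiv I I (fun y ↦ x * y) 1 : TangentSpace I (1 : G) →L[ℝ] TangentSpace I (x * 1))

/-- The differential at `x` of left translation by `x⁻¹`, the inverse of `leftFrame I x`. -/
noncomputable def leftCoord (I : ModelWithCorners ℝ E H) (x : G) : TangentSpace I x →L[ℝ] E :=
  (mfderiv I I (fun y ↦ x⁻¹ * y) x : TangentSpace I x →L[ℝ] TangentSpace I (x⁻¹ * x))

/-- The differential at the identity of conjugation `y ↦ x⁻¹ * y * x`, that is `Ad x⁻¹`. -/
noncomputable def adInv (I : ModelWithCorners ℝ E H) (x : G) : E →L[ℝ] E :=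
  (mfderiv I I (fun y ↦ x⁻¹ * y * x) 1 :
    TangentSpace I (1 : G) →L[ℝ] TangentSpace I (x⁻¹ * 1 * x))

/-- The right-invariant vector field with value `v` at the identity. -/
noncomputable def rightField (I : ModelWithCorners ℝ E H) (v : E) (x : G) : TangentSpace I x :=
  (mfderiv I I (fun y ↦ y * x) (1 : G) v : TangentSpace I (1 * x))

theorem leftFrame_one (v : E) : (leftFrame I (1 : G) v : E) = v := by
  have h4 : (fun y : G ↦ 1 * y) = id := by ext; simp
  unfold leftFrame
  rw [h4, mfderiv_id]
  rfl

theorem adInv_one (v : E) : adInv I (1 : G) v = v := by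
  have h4 : (fun y : G ↦ 1⁻¹ * y * 1) = id := by ext; simp
  unfold adInv
  rw [h4, mfderiv_id]
  rfl

variable [LieGroup I ∞ G]

theorem mdifferentiableAt_mul_left' (a x : G) : MDifferentiableAt I I (fun y ↦ a * y) x :=
  (contMDiff_mul_left (I := I) (n := ∞)).contMDiffAt.mdifferentiableAt (by simp)

theorem mdifferentiableAt_mul_right' (a x : G) : MDifferentiableAt I I (fun y ↦ y * a) x :=
  (contMDiff_mul_right (I := I) (n := ∞)).contMDiffAt.mdifferentiableAt (by simp)

theorem mfderiv_mul_left_leftFrame (a x : G) (v : E) :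
    mfderiv I I (fun y ↦ a * y) x (leftFrame I x v) = leftFrame I (a * x) v := by
  have h := mfderiv_comp_apply_of_eq (I := I) (I' := I) (I'' := I) (x := (1 : G)) (y := x)
    (g := fun y ↦ a * y) (f := fun y ↦ x * y) (mdifferentiableAt_mul_left' a x)
    (mdifferentiableAt_mul_left' x 1) (mul_one x) v
  have h2 : (fun y ↦ a * y) ∘ (fun y ↦ x * y) = fun y ↦ a * x * y := by
    ext y; simp [mul_assoc]
  rw [h2] at h
  exact h.symm

theorem leftCoord_leftFrame (x : G) (v : E) : leftCoord I x (leftFrame I x v) = v := by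
  have h := mfderiv_mul_left_leftFrame (I := I) x⁻¹ x v
  have h3 : ∀ y : G, y = 1 → (leftFrame I y v : E) = v := by
    rintro y rfl
    exact leftFrame_one v
  exact h.trans (h3 _ (inv_mul_cancel x))

theorem leftFrame_leftCoord (x : G) (u : TangentSpace I x) :
    leftFrame I x (leftCoord I x u) = u := by
  have h := mfderiv_comp_apply_of_eq (I := I) (I' := I) (I'' := I) (x := x) (y := (1 : G))
    (g := fun y ↦ x * y) (f := fun y ↦ x⁻¹ * y) (mdifferentiableAt_mul_left' x 1)
    (mdifferentiableAt_mul_left' x⁻¹ x) (inv_mul_cancel x) u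
  have h2 : (fun y ↦ x * y) ∘ (fun y ↦ x⁻¹ * y) = id := by
    ext y; simp
  rw [h2, mfderiv_id] at h
  exact h.symm

/-- Right translation by `a` acts on left coordinates as `Ad a⁻¹`. -/
theorem mfderiv_mul_right_leftFrame (a x : G) (v : E) :
    mfderiv I I (fun y ↦ y * a) x (leftFrame I x v) = leftFrame I (x * a) (adInv I a v) := by
  have h1 := mfderiv_comp_apply_of_eq (I := I) (I' := I) (I'' := I) (x := (1 : G)) (y := x)
    (g := fun y ↦ y * a) (f := fun y ↦ x * y) (mdifferentiableAt_mul_right' a x)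
    (mdifferentiableAt_mul_left' x 1) (mul_one x) v
  have hc : MDifferentiableAt I I (fun y : G ↦ a⁻¹ * y * a) 1 :=
    (mdifferentiableAt_mul_right' a (a⁻¹ * 1)).comp (1 : G) (mdifferentiableAt_mul_left' a⁻¹ 1)
  have h2 := mfderiv_comp_apply_of_eq (I := I) (I' := I) (I'' := I) (x := (1 : G)) (y := (1 : G))
    (g := fun y ↦ x * a * y) (f := fun y ↦ a⁻¹ * y * a) (mdifferentiableAt_mul_left' (x * a) 1)
    hc (by simp) v
  have h3 : (fun y ↦ y * a) ∘ (fun y ↦ x * y) = (fun y ↦ x * a * y) ∘ (fun y ↦ a⁻¹ * y * a) := by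
    ext y; simp [mul_assoc]
  rw [h3] at h1
  exact h1.symm.trans h2

theorem leftCoord_rightField (x : G) (v : E) :
    leftCoord I x (rightField I v x) = adInv I x v := by
  have h := mfderiv_mul_right_leftFrame (I := I) x 1 v
  have h2 : ∀ (y : G) (u : E) (w : E), y = x →
      (u : TangentSpace I y) = leftFrame I y w → leftCoord I x u = w := by
    rintro y u w rfl h
    exact (congrArg (leftCoord I y) h).trans (leftCoord_leftFrame y _)
  refine h2 (1 * x) _ _ (one_mul x) (Eq.trans ?_ h)
  rw [show (leftFrame I (1 : G) v) = v from leftFrame_one v]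
  rfl

theorem adInv_mul (x y : G) (v : E) : adInv I (x * y) v = adInv I y (adInv I x v) := by
  have hc : ∀ a : G, MDifferentiableAt I I (fun y : G ↦ a⁻¹ * y * a) 1 := fun a ↦
    (mdifferentiableAt_mul_right' a (a⁻¹ * 1)).comp (1 : G) (mdifferentiableAt_mul_left' a⁻¹ 1)
  have h2 := mfderiv_comp_apply_of_eq (I := I) (I' := I) (I'' := I) (x := (1 : G)) (y := (1 : G))
    (g := fun z ↦ y⁻¹ * z * y) (f := fun z ↦ x⁻¹ * z * x) (hc y) (hc x) (by simp) v
  have h3 : (fun z ↦ y⁻¹ * z * y) ∘ (fun z ↦ x⁻¹ * z * x) =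
      fun z ↦ (x * y)⁻¹ * z * (x * y) := by
    ext z; simp [mul_assoc]
  rw [h3] at h2
  exact h2

/-- The differential of the multiplication, `((x, u), (y, w)) ↦ (x y, dR_y u + dL_x w)`. -/
theorem tangentMap_mul_prod (p q : TangentBundle I G) :
    tangentMap (I.prod I) I (fun r : G × G ↦ r.1 * r.2)
        ((equivTangentBundleProd I G I G).symm (p, q)) =
      ⟨p.1 * q.1, mfderiv I I (fun y ↦ y * q.1) p.1 p.2 +
        mfderiv I I (fun y ↦ p.1 * y) q.1 q.2⟩ := by
  simp only [tangentMap]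
  rw [mfderiv_prod_eq_add_apply ((contMDiff_mul I ∞).mdifferentiable (by simp) _)]
  rfl

theorem contMDiff_tangentMap_mul : ContMDiff (I.tangent.prod I.tangent) I.tangent ∞
    (fun pq : TangentBundle I G × TangentBundle I G ↦ tangentMap (I.prod I) I
      (fun r : G × G ↦ r.1 * r.2) ((equivTangentBundleProd I G I G).symm pq)) :=
  ((contMDiff_mul I ∞).contMDiff_tangentMap (m := ∞) (by simp)).comp
    contMDiff_equivTangentBundleProd_symm

/-- The left-invariant field is the differential of the multiplication along `((x, 0), (1, v))`. -/
theorem contMDiff_leftField (v : E) : ContMDiff I I.tangent ∞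
    (fun x : G ↦ (⟨x, leftFrame I x v⟩ : TangentBundle I G)) := by
  have h1 : ContMDiff I I.tangent ∞ (fun x : G ↦ (⟨x, 0⟩ : TangentBundle I G)) :=
    contMDiff_zeroSection _ _
  have h2 : ContMDiff I I.tangent ∞ (fun _ : G ↦ (⟨1, v⟩ : TangentBundle I G)) :=
    contMDiff_const
  have h := contMDiff_tangentMap_mul.comp (h1.prodMk h2)
  refine h.congr fun x ↦ ?_
  simp only [Function.comp_apply, tangentMap_mul_prod, map_zero, zero_add]
  have : ∀ y : G, y = x → ∀ u : E, (⟨y, u⟩ : TangentBundle I G) = ⟨x, u⟩ := by rintro y rfl u; rfl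
  exact (this _ (mul_one x) _).symm

/-- The right-invariant field is the differential of the multiplication along `((1, v), (x, 0))`. -/
theorem contMDiff_rightField (v : E) : ContMDiff I I.tangent ∞
    (fun x : G ↦ (⟨x, rightField I v x⟩ : TangentBundle I G)) := by
  have h1 : ContMDiff I I.tangent ∞ (fun x : G ↦ (⟨x, 0⟩ : TangentBundle I G)) :=
    contMDiff_zeroSection _ _
  have h2 : ContMDiff I I.tangent ∞ (fun _ : G ↦ (⟨1, v⟩ : TangentBundle I G)) :=
    contMDiff_const
  have h := contMDiff_tangentMap_mul.comp (h2.prodMk h1)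
  refine h.congr fun x ↦ ?_
  simp only [Function.comp_apply, tangentMap_mul_prod, map_zero, add_zero]
  have : ∀ y : G, y = x → ∀ u : E, (⟨y, u⟩ : TangentBundle I G) = ⟨x, u⟩ := by rintro y rfl u; rfl
  exact (this _ (one_mul x) _).symm

/-- The left coordinates of `Z` are the differential of the multiplication along
`((y⁻¹, 0), (y, Z y))`, a tangent vector at the identity for every `y`. -/
theorem mdifferentiableAt_leftCoord {Z : Π x : G, TangentSpace I x} {x : G}
    (hZ : MDifferentiableAt I I.tangent (fun x ↦ (⟨x, Z x⟩ : TangentBundle I G)) x) :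
    MDifferentiableAt I 𝓘(ℝ, E) (fun y ↦ leftCoord I y (Z y)) x := by
  have h1 : MDifferentiableAt I I.tangent (fun y : G ↦ (⟨y⁻¹, 0⟩ : TangentBundle I G)) x :=
    (((contMDiff_zeroSection ℝ (TangentSpace I : G → Type _) (n := ∞) (IB := I)).comp
      (contMDiff_inv I ∞)).mdifferentiable (by simp)) x
  have h := ((contMDiff_tangentMap_mul (I := I) (G := G)).mdifferentiable (by simp) _).comp x
    (h1.prodMk hZ)
  have h3 : (fun y : G ↦ (⟨1, leftCoord I y (Z y)⟩ : TangentBundle I G)) =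
      (fun pq : TangentBundle I G × TangentBundle I G ↦ tangentMap (I.prod I) I
      (fun r : G × G ↦ r.1 * r.2) ((equivTangentBundleProd I G I G).symm pq)) ∘
      (fun y ↦ (⟨y⁻¹, 0⟩, ⟨y, Z y⟩)) := by
    ext1 y
    simp only [Function.comp_apply, tangentMap_mul_prod, map_zero, zero_add]
    have : ∀ y : G, y = 1 → ∀ u : E, (⟨y, u⟩ : TangentBundle I G) = ⟨1, u⟩ := by
      rintro y rfl u; rfl
    exact (this _ (inv_mul_cancel y) _).symm
  rw [← h3, mdifferentiableAt_totalSpace] at h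
  refine h.2.congr_of_eventuallyEq (Filter.Eventually.of_forall fun y ↦ ?_)
  -- The trivialization at the identity is the identity on the tangent space there.
  have hid := (tangentBundleCore I G).coordChange_self (achart H (1 : G)) 1
    (mem_chart_source H (1 : G)) (leftCoord I y (Z y))
  exact hid.symm

end LeftTrivialization

/-! ### Left-invariant and right-invariant fields commute -/

section Commute

/-- The two mixed second derivatives of `m` at `a`, both taken on the diagonal, agree. -/
theorem fderiv_fderiv_swap {E : Type*} [NormedAddCommGroup E] [NormedSpace ℝ E]
    {m : E × E → E} {a : E} (hm : ContDiffAt ℝ 2 m (a, a)) (X Y : E) :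
    fderiv ℝ (fun u ↦ fderiv ℝ (fun w ↦ m (u, w)) a X) a Y =
      fderiv ℝ (fun w ↦ fderiv ℝ (fun u ↦ m (u, w)) a Y) a X := by
  have hd : ∀ᶠ p in 𝓝 (a, a), DifferentiableAt ℝ m p :=
    (hm.eventually (by simp)).mono fun p hp ↦ hp.differentiableAt (by simp)
  have hd2 : DifferentiableAt ℝ (fderiv ℝ m) (a, a) :=
    (hm.fderiv_right (m := 1) (by norm_num)).differentiableAt (by simp)
  have c1 : Filter.Tendsto (fun u : E ↦ (u, a)) (𝓝 a) (𝓝 (a, a)) :=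
    (Continuous.prodMk_left a).tendsto a
  have c2 : Filter.Tendsto (fun u : E ↦ (a, u)) (𝓝 a) (𝓝 (a, a)) :=
    (Continuous.prodMk_right a).tendsto a
  have e1 : (fun u ↦ fderiv ℝ (fun w ↦ m (u, w)) a X) =ᶠ[𝓝 a]
      fun u ↦ fderiv ℝ m (u, a) (0, X) := by
    filter_upwards [c1.eventually hd] with u hu
    have := hu.hasFDerivAt.comp a (hasFDerivAt_prodMk_right u a)
    exact congrArg (· X) this.fderiv
  have e2 : (fun w ↦ fderiv ℝ (fun u ↦ m (u, w)) a Y) =ᶠ[𝓝 a]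
      fun w ↦ fderiv ℝ m (a, w) (Y, 0) := by
    filter_upwards [c2.eventually hd] with u hu
    have := HasFDerivAt.comp (f := fun e : E ↦ (e, u)) a hu.hasFDerivAt
      (hasFDerivAt_prodMk_left a u)
    exact congrArg (· Y) this.fderiv
  have d1 : fderiv ℝ (fun u ↦ fderiv ℝ m (u, a) (0, X)) a Y =
      fderiv ℝ (fderiv ℝ m) (a, a) (Y, 0) (0, X) := by
    have := (HasFDerivAt.comp (f := fun e : E ↦ (e, a)) a hd2.hasFDerivAt
      (hasFDerivAt_prodMk_left a a)).clm_apply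
      (hasFDerivAt_const ((0 : E), X) a)
    refine (congrArg (· Y) this.fderiv).trans ?_
    simp
  have d2 : fderiv ℝ (fun w ↦ fderiv ℝ m (a, w) (Y, 0)) a X =
      fderiv ℝ (fderiv ℝ m) (a, a) (0, X) (Y, 0) := by
    have := (HasFDerivAt.comp (f := fun e : E ↦ (a, e)) a hd2.hasFDerivAt
      (hasFDerivAt_prodMk_right a a)).clm_apply
      (hasFDerivAt_const (Y, (0 : E)) a)
    refine (congrArg (· X) this.fderiv).trans ?_
    simp
  rw [e1.fderiv_eq, e2.fderiv_eq, d1, d2]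
  exact (hm.isSymmSndFDerivAt (by simp)).eq _ _

variable {E : Type*} [NormedAddCommGroup E] [NormedSpace ℝ E]
  {H : Type*} [TopologicalSpace H] {I : ModelWithCorners ℝ E H} [I.Boundaryless]
  {G : Type*} [TopologicalSpace G] [ChartedSpace H G] [Group G] [LieGroup I ∞ G]

/-- In the chart `φ` at the identity, a field whose value at each `x` is the image of `w` under the
differential at `1` of a map `y ↦ F x y` with `F x 1 = x` is the differential of `F` read in `φ`. -/
theorem mpullback_extChartAt_symm_eq {F : G → G → G} (hF1 : ∀ x, F x 1 = x)
    (hF : ∀ x, MDifferentiableAt I I (F x) 1) (w : E) {u : E}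
    (hu : u ∈ (extChartAt I (1 : G)).target) :
    VectorField.mpullbackWithin 𝓘(ℝ, E) I (extChartAt I (1 : G)).symm
      (fun x ↦ (mfderiv I I (F x) 1 w : TangentSpace I (F x 1))) (range I) u =
    fderiv ℝ (fun y ↦ extChartAt I (1 : G)
      (F ((extChartAt I (1 : G)).symm u) ((extChartAt I (1 : G)).symm y)))
      (extChartAt I (1 : G) 1) w := by
  set φ := extChartAt I (1 : G) with hφ
  have hsrc : φ.symm u ∈ φ.source := φ.map_target hu
  have hsrc' : φ.symm u ∈ (chartAt H (1 : G)).source := by rwa [hφ, extChartAt_source] at hsrc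
  have hinv : (mfderivWithin 𝓘(ℝ, E) I φ.symm (range I) u).inverse =
      mfderiv I 𝓘(ℝ, E) φ (φ.symm u) :=
    ContinuousLinearMap.inverse_eq (mfderivWithin_extChartAt_symm_comp_mfderiv_extChartAt hu)
      (mfderiv_extChartAt_comp_mfderivWithin_extChartAt_symm hu)
  refine (congrArg (fun A ↦ A (mfderiv I I (F (φ.symm u)) 1 w)) hinv).trans ?_
  have hφd : MDifferentiableAt I 𝓘(ℝ, E) φ (φ.symm u) := mdifferentiableAt_extChartAt hsrc'
  have hsd : MDifferentiableAt 𝓘(ℝ, E) I φ.symm (φ 1) := by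
    rw [← mdifferentiableWithinAt_univ, ← I.range_eq_univ]
    exact mdifferentiableWithinAt_extChartAt_symm (mem_extChartAt_target 1)
  have hsi : mfderiv 𝓘(ℝ, E) I φ.symm (φ 1) w = w := by
    rw [← mfderivWithin_univ, ← I.range_eq_univ, mfderivWithin_range_extChartAt_symm]
    rfl
  have h1 : φ.symm (φ 1) = 1 := extChartAt_to_inv 1
  have e1 := mfderiv_comp_apply_of_eq (I := 𝓘(ℝ, E)) (I' := I) (I'' := I) (x := φ 1) (y := (1 : G))
    (g := F (φ.symm u)) (f := φ.symm) (hF _) hsd h1 w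
  have hc : MDifferentiableAt 𝓘(ℝ, E) I (F (φ.symm u) ∘ φ.symm) (φ 1) :=
    MDifferentiableAt.comp (φ 1) (by rw [h1]; exact hF _) hsd
  have e2 := mfderiv_comp_apply_of_eq (I := 𝓘(ℝ, E)) (I' := I) (I'' := 𝓘(ℝ, E)) (x := φ 1)
    (y := φ.symm u) (g := φ) (f := F (φ.symm u) ∘ φ.symm) hφd hc (by simp [h1, hF1]) w
  rw [mfderiv_eq_fderiv, e1, hsi] at e2
  exact e2.symm

/-- In a chart the left- and right-invariant fields are partial derivatives of the multiplication
`m`, in the second and first variable respectively, so that their bracket at the identity is a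
difference of mixed second derivatives of `m`. -/
theorem mlieBracket_leftFrame_rightField (v w : E) :
    VectorField.mlieBracket I (fun x : G ↦ leftFrame I x v) (rightField I w) 1 = 0 := by
  set φ := extChartAt I (1 : G) with hφ
  set m : E × E → E := fun p ↦ φ (φ.symm p.1 * φ.symm p.2) with hm
  have hmc : ContDiffAt ℝ 2 m (φ 1, φ 1) := by
    have hs : ContMDiffAt 𝓘(ℝ, E) I 2 φ.symm (φ 1) :=
      (contMDiffOn_extChartAt_symm (1 : G)).contMDiffAt
        ((isOpen_extChartAt_target (1 : G)).mem_nhds (mem_extChartAt_target 1))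
    have h1 : φ.symm (φ 1) = 1 := extChartAt_to_inv 1
    have hmul := ContMDiffAt.mul
      (ContMDiffAt.comp (f := (Prod.fst : E × E → E)) (I := 𝓘(ℝ, E × E)) (φ 1, φ 1) hs
        contDiffAt_fst.contMDiffAt)
      (ContMDiffAt.comp (f := (Prod.snd : E × E → E)) (I := 𝓘(ℝ, E × E)) (φ 1, φ 1) hs
        contDiffAt_snd.contMDiffAt)
    have := ContMDiffAt.comp (g := φ) (I' := I) (φ 1, φ 1)
      (by simpa only [Pi.mul_apply, Function.comp_apply, h1, mul_one] using!
        contMDiffAt_extChartAt) hmul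
    exact this.contDiffAt
  have hL : VectorField.mpullbackWithin 𝓘(ℝ, E) I φ.symm (fun x : G ↦ leftFrame I x v) (range I)
      =ᶠ[𝓝 (φ 1)] fun u ↦ fderiv ℝ (fun y ↦ m (u, y)) (φ 1) v := by
    filter_upwards [(isOpen_extChartAt_target (1 : G)).mem_nhds
      (mem_extChartAt_target (I := I) 1)] with u hu
    exact mpullback_extChartAt_symm_eq (F := fun x y ↦ x * y) mul_one
      (fun x ↦ mdifferentiableAt_mul_left' x 1) v hu
  have hR : VectorField.mpullbackWithin 𝓘(ℝ, E) I φ.symm (rightField I w) (range I)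
      =ᶠ[𝓝 (φ 1)] fun u ↦ fderiv ℝ (fun y ↦ m (y, u)) (φ 1) w := by
    filter_upwards [(isOpen_extChartAt_target (1 : G)).mem_nhds
      (mem_extChartAt_target (I := I) 1)] with u hu
    exact mpullback_extChartAt_symm_eq (F := fun x y ↦ y * x) one_mul
      (fun x ↦ mdifferentiableAt_mul_right' x 1) w hu
  have hmul1 : ∀ᶠ y in 𝓝 (φ 1), φ (φ.symm y) = y := by
    filter_upwards [(isOpen_extChartAt_target (1 : G)).mem_nhds
      (mem_extChartAt_target (I := I) 1)] with y hy using φ.right_inv hy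
  have h1 : φ.symm (φ 1) = 1 := extChartAt_to_inv 1
  have hv : fderiv ℝ (fun y ↦ m (φ 1, y)) (φ 1) v = v := by
    have : (fun y ↦ m (φ 1, y)) =ᶠ[𝓝 (φ 1)] id := by
      filter_upwards [hmul1] with y hy
      simpa [hm, h1] using hy
    rw [this.fderiv_eq, fderiv_id]
    rfl
  have hw : fderiv ℝ (fun y ↦ m (y, φ 1)) (φ 1) w = w := by
    have : (fun y ↦ m (y, φ 1)) =ᶠ[𝓝 (φ 1)] id := by
      filter_upwards [hmul1] with y hy
      simpa [hm, h1] using hy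
    rw [this.fderiv_eq, fderiv_id]
    rfl
  -- Stated for arbitrary `V`, `W`, so that the pullbacks are compared as plain functions on `E`.
  have key : ∀ V W : E → E, V =ᶠ[𝓝 (φ 1)] (fun u ↦ fderiv ℝ (fun y ↦ m (u, y)) (φ 1) v) →
      W =ᶠ[𝓝 (φ 1)] (fun u ↦ fderiv ℝ (fun y ↦ m (y, u)) (φ 1) w) →
      VectorField.lieBracketWithin ℝ V W (φ.symm ⁻¹' univ ∩ range I) (φ 1) = 0 := by
    intro V W hV hW
    rw [preimage_univ, univ_inter, I.range_eq_univ, VectorField.lieBracketWithin_univ,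
      hV.lieBracket_vectorField_eq hW, VectorField.lieBracket, hv, hw, sub_eq_zero]
    exact (fderiv_fderiv_swap hmc v w).symm
  exact (congrArg (mfderiv I 𝓘(ℝ, E) φ 1).inverse (key _ _ hL hR)).trans (map_zero _)

end Commute

/-! ### Left-invariant connections and the derivative of the adjoint representation -/

section LeftInvariantConnection

variable {E : Type*} [NormedAddCommGroup E] [NormedSpace ℝ E]
  {H : Type*} [TopologicalSpace H] {I : ModelWithCorners ℝ E H}
  {G : Type*} [TopologicalSpace G] [ChartedSpace H G] [Group G] [LieGroup I ∞ G]

variable (I G) in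
/-- The left-invariant connection with `∇_u v = Γ u v` for left-invariant fields `u`, `v`. A field
`Z` with left coordinates `z` has `∇_w Z = dz(w) + Γ(w, z)` in left coordinates. -/
noncomputable def leftInvariantConnection (Γ : E →L[ℝ] E →L[ℝ] E) :
    CovariantDerivative I E (TangentSpace I : G → Type _) where
  toFun Z x := (leftFrame I x).comp
    (mvfderiv I (fun y ↦ leftCoord I y (Z y)) x +
      ((Γ.flip (leftCoord I x (Z x))).comp (leftCoord I x)))
  isCovariantDerivativeOnUniv := by
    constructor
    · intro Z Z' x hZ hZ' _
      ext w
      simp only [ContinuousLinearMap.comp_apply, add_apply, map_add, Pi.add_apply,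
        ContinuousLinearMap.flip_apply,
        mvfderiv_fun_add (mdifferentiableAt_leftCoord hZ) (mdifferentiableAt_leftCoord hZ')]
      abel
    · intro Z f x hZ hf _
      ext w
      simp only [ContinuousLinearMap.comp_apply, add_apply, map_add, Pi.smul_apply', map_smul,
        ContinuousLinearMap.flip_apply, smul_apply, ContinuousLinearMap.smulRight_apply, smul_add,
        mvfderiv_fun_smul hf (mdifferentiableAt_leftCoord hZ), leftFrame_leftCoord]
      abel

theorem leftInvariantConnection_apply (Γ : E →L[ℝ] E →L[ℝ] E) (Z : Π x : G, TangentSpace I x)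
    (x : G) (w : TangentSpace I x) :
    leftInvariantConnection I G Γ Z x w = leftFrame I x
      (mvfderiv I (fun y ↦ leftCoord I y (Z y)) x w + Γ (leftCoord I x w) (leftCoord I x (Z x))) :=
  rfl

theorem mdifferentiableAt_leftField (v : E) (x : G) : MDifferentiableAt I I.tangent
    (fun x : G ↦ (⟨x, leftFrame I x v⟩ : TangentBundle I G)) x :=
  (contMDiff_leftField v).mdifferentiable (by simp) x

theorem leftInvariantConnection_leftFrame (Γ : E →L[ℝ] E →L[ℝ] E) (v : E) (x : G)
    (w : TangentSpace I x) :
    leftInvariantConnection I G Γ (fun x ↦ leftFrame I x v) x w =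
      leftFrame I x (Γ (leftCoord I x w) v) := by
  rw [leftInvariantConnection_apply]
  simp only [leftCoord_leftFrame, mvfderiv_const]
  simp

theorem mdifferentiableAt_adInv (v : E) (x : G) :
    MDifferentiableAt I 𝓘(ℝ, E) (fun x : G ↦ adInv I x v) x := by
  simpa only [leftCoord_rightField] using
    mdifferentiableAt_leftCoord ((contMDiff_rightField (I := I) v).mdifferentiable (by simp) x)

variable [FiniteDimensional ℝ E] [CompleteSpace E]

variable (I G) in
/-- The Lie bracket of the Lie algebra of `G` as a continuous bilinear map on the model space. -/
noncomputable def lieBilin : E →L[ℝ] E →L[ℝ] E :=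
  LinearMap.toContinuousBilinearMap <| LinearMap.mk₂ ℝ
    (Bracket.bracket (L := GroupLieAlgebra I G) (M := GroupLieAlgebra I G) : E → E → E)
    (add_lie (L := GroupLieAlgebra I G) (M := GroupLieAlgebra I G))
    (smul_lie (L := GroupLieAlgebra I G) (M := GroupLieAlgebra I G) (R := ℝ))
    (lie_add (L := GroupLieAlgebra I G) (M := GroupLieAlgebra I G))
    (fun c u v ↦ lie_smul (L := GroupLieAlgebra I G) (M := GroupLieAlgebra I G) c u v)

theorem lieBilin_self (u : E) : lieBilin I G u u = 0 :=
  lie_self (L := GroupLieAlgebra I G) u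

theorem lieBilin_skew (u v : E) : -lieBilin I G u v = lieBilin I G v u :=
  lie_skew (L := GroupLieAlgebra I G) v u

theorem mlieBracket_leftFrame (u v : E) (x : G) :
    VectorField.mlieBracket I (fun x : G ↦ leftFrame I x u) (fun x : G ↦ leftFrame I x v) x =
      leftFrame I x (lieBilin I G u v) :=
  (congrFun (mulInvariantVector_mlieBracket (I := I) (G := G) u v) x).symm

theorem torsion_leftInvariantConnection_apply (Γ : E →L[ℝ] E →L[ℝ] E) (x : G) (u v : E) :
    (leftInvariantConnection I G Γ).torsion x (leftFrame I x u) (leftFrame I x v) =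
      leftFrame I x (Γ u v - Γ v u - lieBilin I G u v) := by
  have h := (leftInvariantConnection I G Γ).torsion_apply
    (mdifferentiableAt_leftField u x) (mdifferentiableAt_leftField v x)
  rw [leftInvariantConnection_leftFrame, leftInvariantConnection_leftFrame] at h
  simp only [leftCoord_leftFrame] at h
  rw [h, mlieBracket_leftFrame, map_sub, map_sub]

theorem torsion_leftInvariantConnection (Γ : E →L[ℝ] E →L[ℝ] E)
    (hΓ : ∀ u v, Γ u v - Γ v u = lieBilin I G u v) :
    (leftInvariantConnection I G Γ).torsion = 0 := by
  ext x u v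
  rw [← leftFrame_leftCoord x u, ← leftFrame_leftCoord x v,
    torsion_leftInvariantConnection_apply, hΓ, sub_self]
  simp

variable [I.Boundaryless]

/-- The differential of `x ↦ Ad x⁻¹ v` at the identity is `-[·, v]`: the field `rightField I v` has
left coordinates `Ad x⁻¹ v` and commutes with left-invariant fields, and the flat connection whose
parallel fields are the left-invariant ones has torsion `-[·, ·]`. -/
theorem mvfderiv_adInv_one (u v : E) :
    mvfderiv I (fun x : G ↦ adInv I x v) 1 (leftFrame I 1 u) = -lieBilin I G u v := by
  have h := (leftInvariantConnection I G (0 : E →L[ℝ] E →L[ℝ] E)).torsion_apply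
    (mdifferentiableAt_leftField u (1 : G))
    ((contMDiff_rightField (I := I) v).mdifferentiable (by simp) (1 : G))
  have hr : rightField I v (1 : G) = leftFrame I (1 : G) v := by
    rw [← leftFrame_leftCoord 1 (rightField I v (1 : G)), leftCoord_rightField, adInv_one]
  rw [mlieBracket_leftFrame_rightField, leftInvariantConnection_leftFrame, hr,
    torsion_leftInvariantConnection_apply, leftInvariantConnection_apply] at h
  simp only [leftCoord_rightField] at h
  have h2 := congrArg (leftCoord I (1 : G)) h
  simpa [leftCoord_leftFrame] using h2.symm

/-- The differential of `x ↦ Ad x⁻¹ v` at `x`, obtained from the one at the identity by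
`Ad (x y)⁻¹ = Ad y⁻¹ ∘ Ad x⁻¹`. -/
theorem mvfderiv_adInv (x : G) (u v : E) :
    mvfderiv I (fun x : G ↦ adInv I x v) x (leftFrame I x u) = -lieBilin I G u (adInv I x v) := by
  rw [← mvfderiv_adInv_one]
  have h := mfderiv_comp_apply_of_eq (I := I) (I' := I) (I'' := 𝓘(ℝ, E)) (x := (1 : G)) (y := x)
    (g := fun y : G ↦ adInv I y v) (f := fun y ↦ x * y) (mdifferentiableAt_adInv v x)
    (mdifferentiableAt_mul_left' x 1) (mul_one x) u
  have h2 : (fun y : G ↦ adInv I y v) ∘ (fun y ↦ x * y) = fun y ↦ adInv I y (adInv I x v) := by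
    ext y; simp [adInv_mul]
  rw [h2] at h
  rw [show leftFrame I (1 : G) u = u from leftFrame_one u]
  exact h.symm

end LeftInvariantConnection

/-! ### The Levi-Civita connection of a left-invariant metric -/

section BilinearAlgebra

variable {E : Type*} [NormedAddCommGroup E] [NormedSpace ℝ E] [FiniteDimensional ℝ E]

/-- The algebraic Koszul formula: a skew bilinear product and an inner product determine a
metric and torsion-free product. -/
theorem exists_koszul {B : E →L[ℝ] E →L[ℝ] ℝ} (hsymm : ∀ u v, B u v = B v u)
    (hpos : ∀ v, v ≠ 0 → 0 < B v v) (L : E →L[ℝ] E →L[ℝ] E) (hL : ∀ u v, L v u = -L u v) :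
    ∃ Γ : E →L[ℝ] E →L[ℝ] E, (∀ u v, Γ u v - Γ v u = L u v) ∧
      ∀ u v w, B (Γ u v) w + B v (Γ u w) = 0 := by
  let κ : E → E → (E →L[ℝ] ℝ) := fun u v ↦
    (1 / 2 : ℝ) • (B (L u v) - (B u).comp (L v) - (B v).comp (L u))
  have hinj : ∀ a b : E, (∀ w, B a w = B b w) → a = b := by
    intro a b h
    by_contra hab
    have := hpos (a - b) (sub_ne_zero.2 hab)
    rw [map_sub] at this
    simp [h] at this
  let b : E →ₗ[ℝ] Module.Dual ℝ E :=
    (ContinuousLinearMap.coeLM ℝ).comp B.toLinearMap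
  have hb : Function.Injective b := fun a c h ↦ hinj a c fun w ↦ LinearMap.congr_fun h w
  let e : E ≃ₗ[ℝ] Module.Dual ℝ E :=
    LinearEquiv.ofInjectiveOfFinrankEq b hb (Subspace.dual_finrank_eq).symm
  have he : ∀ (f : E →L[ℝ] ℝ) w, B (e.symm f.toLinearMap) w = f w := by
    intro f w
    have := LinearMap.congr_fun (e.apply_symm_apply f.toLinearMap) w
    exact this
  let Γ₀ : E →ₗ[ℝ] E →ₗ[ℝ] E := LinearMap.mk₂ ℝ (fun u v ↦ e.symm (κ u v).toLinearMap)
    (by intro a b c; apply hinj; intro w; simp [he, κ]; ring)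
    (by intro a b c; apply hinj; intro w; simp [he, κ]; ring)
    (by intro a b c; apply hinj; intro w; simp [he, κ]; ring)
    (by intro a b c; apply hinj; intro w; simp [he, κ]; ring)
  have hΓ : ∀ u v w, B (Γ₀.toContinuousBilinearMap u v) w =
      1 / 2 * (B (L u v) w - B u (L v w) - B v (L u w)) := by
    intro u v w
    refine (he (κ u v) w).trans ?_
    simp [κ]
  refine ⟨Γ₀.toContinuousBilinearMap, fun u v ↦ ?_, fun u v w ↦ ?_⟩
  · apply hinj
    intro w
    have h : B (-L u v) w = -B (L u v) w := by simp
    rw [map_sub, sub_apply, hΓ, hΓ, hL u v, h]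
    ring
  · rw [hsymm v, hΓ, hΓ, hsymm (L u v), hsymm (L u w), hL v w,
      (B u).map_neg]
    ring

end BilinearAlgebra

section Metric

variable {E : Type*} [NormedAddCommGroup E] [NormedSpace ℝ E]
  {H : Type*} [TopologicalSpace H] {I : ModelWithCorners ℝ E H}
  {G : Type*} [TopologicalSpace G] [ChartedSpace H G] [Group G] [LieGroup I ∞ G]

/-- The inner product at the identity of a Riemannian metric, as a form on the model space. -/
noncomputable def innerOne (g : ContMDiffRiemannianMetric I ∞ E (fun x : G ↦ TangentSpace I x)) :
    E →L[ℝ] E →L[ℝ] ℝ := g.inner 1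

variable {g : ContMDiffRiemannianMetric I ∞ E (fun x : G ↦ TangentSpace I x)}

theorem innerOne_symm (u v : E) : innerOne g u v = innerOne g v u := g.symm 1 u v

theorem innerOne_pos (v : E) (hv : v ≠ 0) : 0 < innerOne g v v := g.pos 1 v hv

theorem IsLeftInvariantMetric.inner_leftFrame (hg : IsLeftInvariantMetric g) (x : G) (u v : E) :
    g.inner x (leftFrame I x u) (leftFrame I x v) = innerOne g u v := by
  have h : ∀ (y : G), y = x → ∀ a b : E, g.inner y a b = g.inner x a b := by rintro y rfl a b; rfl
  exact (h _ (mul_one x) _ _).symm.trans (hg x 1 u v)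

theorem IsLeftInvariantMetric.inner_eq (hg : IsLeftInvariantMetric g) (x : G)
    (u v : TangentSpace I x) :
    g.inner x u v = innerOne g (leftCoord I x u) (leftCoord I x v) := by
  rw [← hg.inner_leftFrame x, leftFrame_leftCoord, leftFrame_leftCoord]

variable [FiniteDimensional ℝ E] [CompleteSpace E]

theorem isLeviCivita_leftInvariantConnection (hg : IsLeftInvariantMetric g)
    {Γ : E →L[ℝ] E →L[ℝ] E} (ht : ∀ u v, Γ u v - Γ v u = lieBilin I G u v)
    (hm : ∀ u v w, innerOne g (Γ u v) w + innerOne g v (Γ u w) = 0) :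
    IsLeviCivita g (leftInvariantConnection I G Γ) := by
  refine ⟨torsion_leftInvariantConnection Γ ht, fun x Y Z hY hZ v ↦ ?_⟩
  have h1 := mdifferentiableAt_leftCoord hY
  have h2 := mdifferentiableAt_leftCoord hZ
  have h3 := ((innerOne g).isBoundedBilinearMap.hasFDerivAt
    (leftCoord I x (Y x), leftCoord I x (Z x))).hasMFDerivAt
  have h4 : mvfderiv I (fun y ↦ innerOne g (leftCoord I y (Y y)) (leftCoord I y (Z y))) x v =
      innerOne g (leftCoord I x (Y x)) (mvfderiv I (fun y ↦ leftCoord I y (Z y)) x v) +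
      innerOne g (mvfderiv I (fun y ↦ leftCoord I y (Y y)) x v) (leftCoord I x (Z x)) :=
    congrArg (· v) (HasMFDerivAt.comp (I' := 𝓘(ℝ, E × E)) x
      (f := fun y ↦ (leftCoord I y (Y y), leftCoord I y (Z y))) h3
      ⟨h1.hasMFDerivAt.1.prodMk h2.hasMFDerivAt.1,
        h1.hasMFDerivAt.2.prodMk h2.hasMFDerivAt.2⟩).mfderiv
  have h5 := hm (leftCoord I x v) (leftCoord I x (Y x)) (leftCoord I x (Z x))
  change mvfderiv I (fun y ↦ g.inner y (Y y) (Z y)) x v = _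
  simp only [hg.inner_eq, leftInvariantConnection_apply, leftCoord_leftFrame, map_add, add_apply,
    h4]
  linarith

theorem exists_isLeviCivita_leftInvariantConnection (hg : IsLeftInvariantMetric g) :
    ∃ Γ : E →L[ℝ] E →L[ℝ] E, IsLeviCivita g (leftInvariantConnection I G Γ) := by
  obtain ⟨Γ, ht, hm⟩ := exists_koszul (B := innerOne g) innerOne_symm innerOne_pos (lieBilin I G)
    fun u v ↦ (lieBilin_skew u v).symm
  exact ⟨Γ, isLeviCivita_leftInvariantConnection hg ht hm⟩

/-- Koszul's formula for `∇_w w` against a left-invariant field. -/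
theorem IsLeviCivita.inner_cov_self (hg : IsLeftInvariantMetric g)
    {cov : CovariantDerivative I E (TangentSpace I : G → Type _)} (hcov : IsLeviCivita g cov)
    (x : G) (w u : E) :
    g.inner x (cov (fun y ↦ leftFrame I y w) x (leftFrame I x w)) (leftFrame I x u) =
      -innerOne g w (lieBilin I G w u) := by
  have ht := cov.torsion_apply (mdifferentiableAt_leftField w x) (mdifferentiableAt_leftField u x)
  have h1 : mvfderiv I (fun y ↦ g.inner y (leftFrame I y w) (leftFrame I y u)) x
      (leftFrame I x w) = _ :=
    hcov.2 x _ _ (mdifferentiableAt_leftField w x) (mdifferentiableAt_leftField u x)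
    (leftFrame I x w)
  have h2 : mvfderiv I (fun y ↦ g.inner y (leftFrame I y w) (leftFrame I y w)) x
      (leftFrame I x u) = _ :=
    hcov.2 x _ _ (mdifferentiableAt_leftField w x) (mdifferentiableAt_leftField w x)
    (leftFrame I x u)
  simp only [hg.inner_leftFrame, mvfderiv_const, zero_apply] at h1 h2
  rw [hcov.1, mlieBracket_leftFrame] at ht
  have ht0 : (0 : TangentSpace I x) = _ := ht
  have ht' : cov (fun y ↦ leftFrame I y u) x (leftFrame I x w) =
      cov (fun y ↦ leftFrame I y w) x (leftFrame I x u) + leftFrame I x (lieBilin I G w u) := by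
    rw [eq_comm, sub_sub, sub_eq_zero] at ht0
    exact ht0
  rw [ht', map_add, hg.inner_leftFrame] at h1
  have h3 := g.symm x (leftFrame I x w) (cov (fun y ↦ leftFrame I y w) x (leftFrame I x u))
  linarith

theorem IsLeviCivita.innerOne_leftCoord_cov_self (hg : IsLeftInvariantMetric g)
    {cov : CovariantDerivative I E (TangentSpace I : G → Type _)} (hcov : IsLeviCivita g cov)
    (x : G) (w u : E) :
    innerOne g (leftCoord I x (cov (fun y ↦ leftFrame I y w) x (leftFrame I x w))) u =
      -innerOne g w (lieBilin I G w u) := by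
  rw [← hcov.inner_cov_self hg x, hg.inner_eq, leftCoord_leftFrame]

/-- For left-invariant `w`, the vector `∇_w w` vanishes if and only if `w` is orthogonal to
`[w, 𝔤]`. -/
theorem IsLeviCivita.cov_self_eq_zero_iff (hg : IsLeftInvariantMetric g)
    {cov : CovariantDerivative I E (TangentSpace I : G → Type _)} (hcov : IsLeviCivita g cov)
    (x : G) (w : E) :
    cov (fun y ↦ leftFrame I y w) x (leftFrame I x w) = 0 ↔
      ∀ u, innerOne g w (lieBilin I G w u) = 0 := by
  constructor
  · intro h u
    have := hcov.innerOne_leftCoord_cov_self hg x w u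
    rw [h] at this
    simpa using this
  · intro h
    rw [← leftFrame_leftCoord x (cov _ x _)]
    by_contra hne
    set n := leftCoord I x (cov (fun y ↦ leftFrame I y w) x (leftFrame I x w)) with hn
    have hn0 : n ≠ 0 := fun h0 ↦ hne (by rw [h0, map_zero])
    have := innerOne_pos (g := g) n hn0
    rw [hn, hcov.innerOne_leftCoord_cov_self hg, h] at this
    simp at this

end Metric

/-! ### Covariant derivatives along curves -/

section AlongCurves

variable {E : Type*} [NormedAddCommGroup E] [NormedSpace ℝ E]
  {H : Type*} [TopologicalSpace H] {I : ModelWithCorners ℝ E H}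
  {M : Type*} [TopologicalSpace M] [ChartedSpace H M] [IsManifold I 1 M]
  (cov : CovariantDerivative I E (TangentSpace I : M → Type _))

/-- The Leibniz rule for a finite combination of fields; its differentiability is part of the
induction. -/
theorem cov_sum_smul {ι : Type*} (S : Finset ι) {f : ι → M → ℝ} {σ : ι → Π x : M, TangentSpace I x}
    {p : M} (hf : ∀ i, MDifferentiableAt I 𝓘(ℝ, ℝ) (f i) p)
    (hσ : ∀ i, MDifferentiableAt I I.tangent (fun x ↦ (⟨x, σ i x⟩ : TangentBundle I M)) p) :
    MDifferentiableAt I I.tangent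
      (fun x ↦ (⟨x, (∑ i ∈ S, f i • σ i) x⟩ : TangentBundle I M)) p ∧
    cov (∑ i ∈ S, f i • σ i) p =
      ∑ i ∈ S, (f i p • cov (σ i) p + (mvfderiv I (f i) p).smulRight (σ i p)) := by
  classical
  induction S using Finset.induction_on with
  | empty =>
    simp only [Finset.sum_empty]
    exact ⟨mdifferentiable_zeroSection ℝ (TangentSpace I : M → Type _) p, by simp⟩
  | insert i S hi ih =>
    rw [Finset.sum_insert hi, Finset.sum_insert hi]
    have h1 := (hf i).smul_section (hσ i)
    exact ⟨mdifferentiableAt_add_section h1 ih.1, by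
      rw [cov.isCovariantDerivativeOnUniv.add h1 ih.1,
        cov.isCovariantDerivativeOnUniv.leibniz (hσ i) (hf i), ih.2]⟩

theorem mdifferentiableAt_symm_trivializationAt {p : M} {ζ : M → E}
    (hζ : MDifferentiableAt I 𝓘(ℝ, E) ζ p) :
    MDifferentiableAt I I.tangent (fun x ↦ (⟨x,
      (trivializationAt E (TangentSpace I : M → Type _) p).symm x (ζ x)⟩ :
        TangentBundle I M)) p := by
  refine (mdifferentiableAt_section I (F := E) (E := (TangentSpace I : M → Type _)) _).2 ?_
  refine hζ.congr_of_eventuallyEq ?_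
  filter_upwards [(trivializationAt E (TangentSpace I : M → Type _) p).open_baseSet.mem_nhds
    (FiberBundle.mem_baseSet_trivializationAt' p)] with x hx
  exact congrArg Prod.snd (Trivialization.apply_mk_symm _ hx (ζ x))

theorem trivializationAt_symm_map_add {p x : M}
    (hx : x ∈ (trivializationAt E (TangentSpace I : M → Type _) p).baseSet) (u v : E) :
    (trivializationAt E (TangentSpace I : M → Type _) p).symm x (u + v) =
      (trivializationAt E (TangentSpace I : M → Type _) p).symm x u +
      (trivializationAt E (TangentSpace I : M → Type _) p).symm x v := by
  have h := Trivialization.coe_symmₗ (R := ℝ)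
    (trivializationAt E (TangentSpace I : M → Type _) p) hx
  rw [← h, map_add]

theorem trivializationAt_symm_map_smul {p x : M}
    (hx : x ∈ (trivializationAt E (TangentSpace I : M → Type _) p).baseSet) (k : ℝ) (u : E) :
    (trivializationAt E (TangentSpace I : M → Type _) p).symm x (k • u) =
      k • (trivializationAt E (TangentSpace I : M → Type _) p).symm x u := by
  have h := Trivialization.coe_symmₗ (R := ℝ)
    (trivializationAt E (TangentSpace I : M → Type _) p) hx
  rw [← h, map_smul]

theorem trivializationAt_symm_map_sum {p x : M}
    (hx : x ∈ (trivializationAt E (TangentSpace I : M → Type _) p).baseSet)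
    {ι : Type*} (S : Finset ι) (k : ι → ℝ) (u : ι → E) :
    (trivializationAt E (TangentSpace I : M → Type _) p).symm x (∑ i ∈ S, k i • u i) =
      ∑ i ∈ S, k i • (trivializationAt E (TangentSpace I : M → Type _) p).symm x (u i) := by
  have h := Trivialization.coe_symmₗ (R := ℝ)
    (trivializationAt E (TangentSpace I : M → Type _) p) hx
  simp only [← h, map_sum, map_smul]

variable [FiniteDimensional ℝ E]

/-- The Leibniz rule in a trivialization: a field with components `ζ` has covariant derivative
`dζ` plus the covariant derivative of the field with constant components `ζ p`. -/
theorem cov_symm_trivializationAt {p : M} {ζ : M → E}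
    (hζ : MDifferentiableAt I 𝓘(ℝ, E) ζ p) (v : TangentSpace I p) :
    cov (fun x ↦ (trivializationAt E (TangentSpace I : M → Type _) p).symm x (ζ x)) p v =
      (trivializationAt E (TangentSpace I : M → Type _) p).symm p (mvfderiv I ζ p v) +
      cov (fun x ↦ (trivializationAt E (TangentSpace I : M → Type _) p).symm x (ζ p)) p v := by
  set e := trivializationAt E (TangentSpace I : M → Type _) p with he
  have hp : p ∈ e.baseSet := FiberBundle.mem_baseSet_trivializationAt' p
  let b := Module.finBasis ℝ E
  let c : Fin (Module.finrank ℝ E) → E →L[ℝ] ℝ := fun i ↦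
    LinearMap.toContinuousLinearMap (b.coord i)
  have hb : ∀ u : E, ∑ i, c i u • b i = u := b.sum_repr
  have key : ∀ ξ : M → E, MDifferentiableAt I 𝓘(ℝ, E) ξ p →
      cov (fun x ↦ e.symm x (ξ x)) p v =
        ∑ i, c i (ξ p) • cov (fun x ↦ e.symm x (b i)) p v + e.symm p (mvfderiv I ξ p v) := by
    intro ξ hξ
    have hc : ∀ i, HasMFDerivAt I 𝓘(ℝ, ℝ) (fun x ↦ c i (ξ x)) p ((c i).comp (mvfderiv I ξ p)) :=
      fun i ↦ (c i).hasMFDerivAt.comp p hξ.hasMFDerivAt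
    have hs := cov_sum_smul cov Finset.univ (f := fun i x ↦ c i (ξ x))
      (σ := fun i x ↦ e.symm x (b i)) (p := p) (fun i ↦ (hc i).mdifferentiableAt)
      (fun i ↦ mdifferentiableAt_symm_trivializationAt mdifferentiableAt_const)
    have hsum : ∀ᶠ x in 𝓝 p, e.symm x (ξ x) =
        (∑ i, (fun x ↦ c i (ξ x)) • (fun x ↦ e.symm x (b i)) : Π x, TangentSpace I x) x := by
      filter_upwards [e.open_baseSet.mem_nhds hp] with x hx
      rw [Finset.sum_apply]
      conv_lhs => rw [← hb (ξ x)]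
      exact trivializationAt_symm_map_sum hx _ _ _
    rw [cov.isCovariantDerivativeOnUniv.congr_of_eventuallyEq
      (mdifferentiableAt_symm_trivializationAt hξ) hs.1 Filter.univ_mem hsum, hs.2,
      sum_apply]
    have hd : ∀ i, mvfderiv I (fun x ↦ c i (ξ x)) p v = c i (mvfderiv I ξ p v) :=
      fun i ↦ congrArg (· v) (hc i).mfderiv
    simp only [add_apply, smul_apply, ContinuousLinearMap.smulRight_apply, hd,
      Finset.sum_add_distrib]
    congr 1
    conv_rhs => rw [← hb (mvfderiv I ξ p v)]
    exact (trivializationAt_symm_map_sum hp _ _ _).symm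
  have h0 : e.symm p (0 : E) = 0 := by
    simpa using trivializationAt_symm_map_smul hp 0 (0 : E)
  rw [key ζ hζ, key (fun _ ↦ ζ p) mdifferentiableAt_const, mvfderiv_const, add_comm]
  simp [h0]

/-- If `W` is, near the time `t`, the multiple `k` of a vector field `Z` restricted to the curve
`γ`, then `DW/dt = k' Z + k ∇_{γ'} Z`. -/
theorem covDerivAlong_eq {γ : ℝ → M} {W : Π t : ℝ, TangentSpace I (γ t)}
    {Z : Π x : M, TangentSpace I x} {k : ℝ → ℝ} {k' t : ℝ}
    (hγ : MDifferentiableAt 𝓘(ℝ, ℝ) I γ t)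
    (hZ : MDifferentiableAt I I.tangent (fun x ↦ (⟨x, Z x⟩ : TangentBundle I M)) (γ t))
    (hk : HasDerivAt k k' t) (hW : ∀ᶠ s in 𝓝 t, W s = k s • Z (γ s)) :
    covDerivAlong cov γ W t = k' • Z (γ t) + k t • cov Z (γ t) (velocity γ t) := by
  set e := trivializationAt E (TangentSpace I : M → Type _) (γ t) with he
  set z : M → E := fun x ↦ (e ⟨x, Z x⟩).2 with hz
  have hzd : MDifferentiableAt I 𝓘(ℝ, E) z (γ t) := (mdifferentiableAt_section I (F := E)
    (E := (TangentSpace I : M → Type _)) _).1 hZ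
  have hp : γ t ∈ e.baseSet := FiberBundle.mem_baseSet_trivializationAt' (γ t)
  have hbase : ∀ᶠ x in 𝓝 (γ t), x ∈ e.baseSet := e.open_baseSet.mem_nhds hp
  have hw : (fun s ↦ (e ⟨γ s, W s⟩).2) =ᶠ[𝓝 t] fun s ↦ k s • z (γ s) := by
    filter_upwards [hW, hγ.continuousAt.eventually hbase] with s hs hs'
    rw [hs]
    exact (e.linear ℝ hs').map_smul (k s) (Z (γ s))
  have hzγ : HasDerivAt (fun s ↦ z (γ s)) (mvfderiv I z (γ t) (velocity γ t)) t := by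
    have h : HasFDerivAt (fun s ↦ z (γ s))
        ((mvfderiv I z (γ t)).comp (mfderiv 𝓘(ℝ, ℝ) I γ t) : ℝ →L[ℝ] E) t :=
      (hzd.hasMFDerivAt.comp t hγ.hasMFDerivAt).hasFDerivAt
    exact h.hasDerivAt
  have hderiv := ((hk.smul hzγ).congr_of_eventuallyEq hw).deriv
  change e.symm (γ t) (deriv (fun s ↦ (e ⟨γ s, W s⟩).2) t) +
    cov (fun x ↦ e.symm x ((e ⟨γ t, W t⟩).2)) (γ t) (velocity γ t) = _
  have hsz : ∀ᶠ x in 𝓝 (γ t), Z x = e.symm x (z x) := by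
    filter_upwards [hbase] with x hx using (Trivialization.symm_apply_apply_mk e hx (Z x)).symm
  have hconst : cov (fun x ↦ e.symm x (k t • z (γ t))) (γ t) =
      k t • cov (fun x ↦ e.symm x (z (γ t))) (γ t) := by
    rw [← cov.isCovariantDerivativeOnUniv.smul_const (k t)
      (mdifferentiableAt_symm_trivializationAt mdifferentiableAt_const)]
    refine cov.isCovariantDerivativeOnUniv.congr_of_eventuallyEq
      (mdifferentiableAt_symm_trivializationAt mdifferentiableAt_const)
      (mdifferentiableAt_const.smul_section
        (mdifferentiableAt_symm_trivializationAt mdifferentiableAt_const)) Filter.univ_mem ?_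
    filter_upwards [hbase] with x hx using trivializationAt_symm_map_smul hx _ _
  rw [hderiv, show (e ⟨γ t, W t⟩).2 = _ from hw.self_of_nhds, hconst,
    cov.isCovariantDerivativeOnUniv.congr_of_eventuallyEq hZ
    (mdifferentiableAt_symm_trivializationAt hzd) Filter.univ_mem hsz,
    cov_symm_trivializationAt cov hzd, trivializationAt_symm_map_add hp,
    trivializationAt_symm_map_smul hp, trivializationAt_symm_map_smul hp,
    ← hsz.self_of_nhds, smul_apply, smul_add]
  abel

end AlongCurves

/-! ### Integral curves and flows of left-invariant fields -/

section IntegralCurves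

variable {E : Type*} [NormedAddCommGroup E] [NormedSpace ℝ E]
  {H : Type*} [TopologicalSpace H] {I : ModelWithCorners ℝ E H}

/-- Integral curves of smooth vector fields are smooth: in a chart `γ' = F ∘ γ`, so that each order
of differentiability of `γ` gives the next one. -/
theorem contMDiffOn_of_isMIntegralCurveOn
    {M : Type*} [TopologicalSpace M] [ChartedSpace H M] [IsManifold I ∞ M]
    {X : Π x : M, TangentSpace I x}
    (hX : ContMDiff I I.tangent ∞ (fun x ↦ (⟨x, X x⟩ : TangentBundle I M)))
    {γ : ℝ → M} {J : Set ℝ} (hJ : IsOpen J) (hγ : IsMIntegralCurveOn γ X J) :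
    ContMDiffOn 𝓘(ℝ, ℝ) I ∞ γ J := by
  rw [contMDiffOn_infty]
  intro n
  induction n with
  | zero => exact contMDiffOn_zero_iff.2 hγ.continuousOn
  | succ n ih =>
    intro t ht
    have hat : IsMIntegralCurveAt γ X t := hγ.isMIntegralCurveAt (hJ.mem_nhds ht)
    refine ContMDiffAt.contMDiffWithinAt (contMDiffAt_iff_target.2 ⟨hat.continuousAt, ?_⟩)
    rw [contMDiffAt_iff_contDiffAt]
    set F : M → E := fun x ↦ (trivializationAt E (TangentSpace I : M → Type _) (γ t) ⟨x, X x⟩).2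
    have hF : ContMDiffAt I 𝓘(ℝ, E) ∞ F (γ t) :=
      (contMDiffAt_section (IB := I) (F := E) (E := (TangentSpace I : M → Type _)) _).1 (hX (γ t))
    have hFγ : ContDiffAt ℝ n (fun s ↦ F (γ s)) t :=
      ((hF.of_le (by exact_mod_cast le_top)).comp t (ih.contMDiffAt (hJ.mem_nhds ht))).contDiffAt
    push_cast
    rw [contDiffAt_succ_iff_hasFDerivAt]
    refine ⟨fun s ↦ ContinuousLinearMap.toSpanSingleton ℝ (F (γ s)), ⟨_, hat.eventually_hasDerivAt,
      fun s hs ↦ hs.hasFDerivAt⟩, ?_⟩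
    exact (ContinuousLinearMap.toSpanSingletonCLE (𝕜 := ℝ) (E := E)).contDiff.contDiffAt.comp t hFγ

theorem velocity_eq_of_isMIntegralCurveOn
    {M : Type*} [TopologicalSpace M] [ChartedSpace H M] {X : Π x : M, TangentSpace I x}
    {γ : ℝ → M} {J : Set ℝ}
    (hJ : IsOpen J) (hγ : IsMIntegralCurveOn γ X J) {t : ℝ} (ht : t ∈ J) :
    velocity (I := I) γ t = X (γ t) := by
  rw [velocity, ((hγ t ht).hasMFDerivAt (hJ.mem_nhds ht)).mfderiv]
  exact one_smul ℝ (X (γ t))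

variable {G : Type*} [TopologicalSpace G] [ChartedSpace H G] [Group G] [LieGroup I ∞ G]

theorem isMIntegralCurveOn_mul_left {X : E} {c : ℝ → G} {J : Set ℝ}
    (hc : IsMIntegralCurveOn c (fun x : G ↦ leftFrame I x X) J) (a : G) :
    IsMIntegralCurveOn (fun t ↦ a * c t) (fun x : G ↦ leftFrame I x X) J := by
  intro t ht
  have h := (mdifferentiableAt_mul_left' (I := I) a (c t)).hasMFDerivAt.comp_hasMFDerivWithinAt t
    (hc t ht)
  refine h.congr_mfderiv ?_
  refine ContinuousLinearMap.ext fun (r : ℝ) ↦ ?_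
  refine ((mfderiv I I (fun y ↦ a * y) (c t)).map_smul r (leftFrame I (c t) X)).trans ?_
  rw [mfderiv_mul_left_leftFrame]
  rfl

/-- Left-invariant fields have integral curves through the identity for small time. -/
theorem exists_oneParameter [CompleteSpace E] [BoundarylessManifold I G] (X : E) :
    ∃ (c : ℝ → G) (ε : ℝ), 0 < ε ∧ c 0 = 1 ∧
      IsMIntegralCurveOn c (fun x : G ↦ leftFrame I x X) (Ioo (-ε) ε) := by
  obtain ⟨c, hc0, hc⟩ := exists_isMIntegralCurveAt_of_contMDiffAt_boundaryless (I := I) 0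
    (((contMDiff_leftField (I := I) (G := G) X) 1).of_le (by simp))
  obtain ⟨ε, hε, h⟩ := isMIntegralCurveAt_iff'.1 hc
  refine ⟨c, ε, hε, hc0, ?_⟩
  simpa [Real.ball_eq_Ioo] using h

/-- Right translations by a one-parameter curve form a local flow of a left-invariant field. -/
theorem isLocalFlow_mul_right {X : E} {c : ℝ → G} {ε : ℝ} (hε : 0 < ε) (hc0 : c 0 = 1)
    (hc : IsMIntegralCurveOn c (fun x : G ↦ leftFrame I x X) (Ioo (-ε) ε)) :
    IsLocalFlow (fun x : G ↦ leftFrame I x X) univ ε (fun t p ↦ p * c t) where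
  isOpen := isOpen_univ
  pos := hε
  contMDiffOn := by
    have h := contMDiffOn_of_isMIntegralCurveOn (contMDiff_leftField X) isOpen_Ioo hc
    exact ContMDiffOn.mul contMDiffOn_snd (h.comp contMDiffOn_fst fun q hq ↦ hq.1)
  zero p _ := by simp [hc0]
  integral p _ := isMIntegralCurveOn_mul_left hc p

/-- A local flow of a left-invariant field is right translation by a curve `c`. -/
theorem IsLocalFlow.exists_eq_mul_right [T2Space G] [BoundarylessManifold I G] [CompleteSpace E]
    {X : E} {U : Set G} {ε : ℝ} {φ : ℝ → G → G}
    (hφ : IsLocalFlow (fun x : G ↦ leftFrame I x X) U ε φ) (hU : U.Nonempty) :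
    ∃ c : ℝ → G, c 0 = 1 ∧ IsMIntegralCurveOn c (fun x : G ↦ leftFrame I x X) (Ioo (-ε) ε) ∧
      ∀ p ∈ U, ∀ t ∈ Ioo (-ε) ε, φ t p = p * c t := by
  obtain ⟨p₀, hp₀⟩ := hU
  have hc := isMIntegralCurveOn_mul_left (hφ.integral p₀ hp₀) p₀⁻¹
  refine ⟨fun t ↦ p₀⁻¹ * φ t p₀, by simp [hφ.zero p₀ hp₀], hc, fun p hp ↦ ?_⟩
  refine isMIntegralCurveOn_Ioo_eqOn_of_contMDiff_boundaryless (I := I) (t₀ := 0)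
    (by simp [hφ.pos]) ((contMDiff_leftField (I := I) (G := G) X).of_le (by simp))
    (hφ.integral p hp) (isMIntegralCurveOn_mul_left hc p) ?_
  simp [hφ.zero p hp, hφ.zero p₀ hp₀]

/-- Right translation by `a` maps integral curves of `X` to integral curves of `Ad a⁻¹ X`. -/
theorem isMIntegralCurveOn_mul_right {X : E} {c : ℝ → G} {J : Set ℝ}
    (hc : IsMIntegralCurveOn c (fun x : G ↦ leftFrame I x X) J) (a : G) :
    IsMIntegralCurveOn (fun t ↦ c t * a) (fun x : G ↦ leftFrame I x (adInv I a X)) J := by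
  intro t ht
  have h := (mdifferentiableAt_mul_right' (I := I) a (c t)).hasMFDerivAt.comp_hasMFDerivWithinAt t
    (hc t ht)
  refine h.congr_mfderiv ?_
  refine ContinuousLinearMap.ext fun (r : ℝ) ↦ ?_
  refine ((mfderiv I I (fun y ↦ y * a) (c t)).map_smul r (leftFrame I (c t) X)).trans ?_
  rw [mfderiv_mul_right_leftFrame]
  rfl

/-- Along an integral curve of `X`, the function `Ad c⁻¹ v` has derivative `-[X, Ad c⁻¹ v]`. -/
theorem hasDerivAt_adInv [FiniteDimensional ℝ E] [CompleteSpace E] [I.Boundaryless]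
    {X : E} {c : ℝ → G} {J : Set ℝ} (hJ : IsOpen J)
    (hc : IsMIntegralCurveOn c (fun x : G ↦ leftFrame I x X) J) (v : E) {t : ℝ} (ht : t ∈ J) :
    HasDerivAt (fun s ↦ adInv I (c s) v) (-lieBilin I G X (adInv I (c t) v)) t := by
  have h : HasFDerivAt (fun s ↦ adInv I (c s) v)
      ((mvfderiv I (fun x : G ↦ adInv I x v) (c t)).comp
        ((1 : ℝ →L[ℝ] ℝ).smulRight (leftFrame I (c t) X)) : ℝ →L[ℝ] E) t :=
    ((mdifferentiableAt_adInv v (c t)).hasMFDerivAt.comp t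
      ((hc t ht).hasMFDerivAt (hJ.mem_nhds ht))).hasFDerivAt
  simpa [mvfderiv_adInv] using! h.hasDerivAt

end IntegralCurves

/-! ### Reparametrized geodesics -/

section Reparametrization

variable {E : Type*} [NormedAddCommGroup E] [NormedSpace ℝ E] [FiniteDimensional ℝ E]
  {H : Type*} [TopologicalSpace H] {I : ModelWithCorners ℝ E H}
  {M : Type*} [TopologicalSpace M] [ChartedSpace H M] [IsManifold I 1 M]

/-- If an integral curve of `Z` is a reparametrized geodesic, `∇_Z Z` is proportional to `Z`
along it. -/
theorem exists_cov_self_eq_smul_of_isReparametrizedGeodesicOn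
    {cov : CovariantDerivative I E (TangentSpace I : M → Type _)}
    {c : ℝ → M} {J : Set ℝ} (hJ : IsOpen J) (hc : IsReparametrizedGeodesicOn cov c J)
    {Z : Π x : M, TangentSpace I x} (hcZ : IsMIntegralCurveOn c Z J) {t : ℝ} (ht : t ∈ J)
    (hZ : MDifferentiableAt I I.tangent (fun x ↦ (⟨x, Z x⟩ : TangentBundle I M)) (c t)) :
    ∃ r : ℝ, cov Z (c t) (Z (c t)) = r • Z (c t) := by
  obtain ⟨β, h, hh, hh', ⟨hβ, hgeo⟩, hcβ⟩ := hc
  have hdiff : ∀ s ∈ J, HasDerivAt h (deriv h s) s := fun s hs ↦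
    ((hh.contDiffAt (hJ.mem_nhds hs)).differentiableAt (by simp)).hasDerivAt
  have hstrict : HasStrictDerivAt h (deriv h t) t :=
    (hh.contDiffAt (hJ.mem_nhds ht)).hasStrictDerivAt (by simp)
  have hd2 : DifferentiableAt ℝ (deriv h) t :=
    ((hh.deriv_of_isOpen (m := 1) hJ (by norm_cast)).contDiffAt (hJ.mem_nhds ht)).differentiableAt
      (by simp)
  -- Only the geodesic equation of `β` is available, so `β` is written near `h t` as `c` composed
  -- with a local inverse `l` of `h`; its velocity is the multiple `1 / h'(l σ)` of `Z`.
  set l := hstrict.localInverse h (deriv h t) t (hh' t ht) with hl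
  have hlt : l (h t) = t := HasStrictFDerivAt.localInverse_apply_image _
  have hlr : ∀ᶠ σ in 𝓝 (h t), h (l σ) = σ := HasStrictFDerivAt.eventually_right_inverse _
  have hld : HasStrictDerivAt l (deriv h t)⁻¹ (h t) := hstrict.to_localInverse (hh' t ht)
  have hlJ : ∀ᶠ σ in 𝓝 (h t), l σ ∈ J :=
    hld.hasDerivAt.continuousAt.eventually (by rw [hlt]; exact hJ.mem_nhds ht)
  have himg : ∀ᶠ σ in 𝓝 (h t), h '' J ∈ 𝓝 σ := by
    rw [eventually_mem_nhds_iff]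
    filter_upwards [hlr, hlJ] with σ h1 h2 using ⟨l σ, h2, h1⟩
  have hβd : ∀ σ, h '' J ∈ 𝓝 σ → MDifferentiableAt 𝓘(ℝ, ℝ) I β σ := fun σ hσ ↦
    (hβ.contMDiffAt hσ).mdifferentiableAt (by simp)
  have hvel : ∀ s ∈ J, ∀ σ, h s = σ → h '' J ∈ 𝓝 σ →
      velocity (I := I) β σ = (deriv h s)⁻¹ • Z (β σ) := by
    rintro s hs _ rfl hσ
    have hev : β ∘ h =ᶠ[𝓝 s] c := by
      filter_upwards [hJ.mem_nhds hs] with x hx using (hcβ x hx).symm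
    have h1 : HasMFDerivAt 𝓘(ℝ, ℝ) I (β ∘ h) s ((1 : ℝ →L[ℝ] ℝ).smulRight (Z (c s))) :=
      ((hcZ s hs).hasMFDerivAt (hJ.mem_nhds hs)).congr_of_eventuallyEq hev
    have h2 := (hβd _ hσ).hasMFDerivAt.comp s (hdiff s hs).hasFDerivAt.hasMFDerivAt
    have h3 := congrArg (fun A : ℝ →L[ℝ] E ↦ A 1) (hasMFDerivAt_unique h1 h2)
    have h4 : Z (β (h s)) = deriv h s • velocity (I := I) β (h s) := by
      have hZc : ∀ x y : M, x = y → (Z x : E) = Z y := by rintro x _ rfl; rfl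
      have h5 : (1 : ℝ) • (Z (c s) : E) = mfderiv 𝓘(ℝ, ℝ) I β (h s) ((1 : ℝ) • deriv h s) := h3
      rw [one_smul, one_smul] at h5
      refine (hZc _ _ (hcβ s hs).symm).trans (h5.trans ?_)
      rw [velocity]
      refine Eq.trans ?_ ((mfderiv 𝓘(ℝ, ℝ) I β (h s)).map_smul (deriv h s) (1 : ℝ))
      exact congrArg (mfderiv 𝓘(ℝ, ℝ) I β (h s)) (mul_one (deriv h s)).symm
    rw [h4, inv_smul_smul₀ (hh' s hs)]
  obtain ⟨k', hk⟩ : ∃ k', HasDerivAt (fun σ ↦ (deriv h (l σ))⁻¹) k' (h t) := by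
    refine ⟨_, (DifferentiableAt.inv (DifferentiableAt.comp (h t) (g := deriv h) ?_
      hld.hasDerivAt.differentiableAt) ?_).hasDerivAt⟩
    · rw [hlt]; exact hd2
    · simpa [hlt] using hh' t ht
  have hct : c t = β (h t) := hcβ t ht
  have hW : ∀ᶠ σ in 𝓝 (h t), velocity (I := I) β σ = (deriv h (l σ))⁻¹ • Z (β σ) := by
    filter_upwards [hlr, hlJ, himg] with σ h1 h2 h3 using hvel _ h2 σ h1 h3
  have hZ' : MDifferentiableAt I I.tangent (fun x ↦ (⟨x, Z x⟩ : TangentBundle I M)) (β (h t)) :=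
    hct ▸ hZ
  have key := covDerivAlong_eq cov (hβd _ himg.self_of_nhds) hZ' hk hW
  rw [hgeo _ (mem_image_of_mem h ht), hW.self_of_nhds, hlt, map_smul, smul_smul] at key
  rw [hct]
  have hne : (deriv h t)⁻¹ * (deriv h t)⁻¹ ≠ 0 := by simpa using hh' t ht
  -- The geodesic equation reads `0 = k' Z + (1 / h')² ∇_Z Z`.
  refine ⟨((deriv h t)⁻¹ * (deriv h t)⁻¹)⁻¹ * (-k'), ?_⟩
  rw [mul_smul, neg_smul, eq_inv_smul_iff₀ hne, eq_neg_iff_add_eq_zero, add_comm]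
  exact key.symm

end Reparametrization

/-! ### Affine and projective left-invariant fields -/

section RightTranslation

variable {E : Type*} [NormedAddCommGroup E] [NormedSpace ℝ E]
  {H : Type*} [TopologicalSpace H] {I : ModelWithCorners ℝ E H}
  {G : Type*} [TopologicalSpace G] [ChartedSpace H G] [Group G] [LieGroup I ∞ G]

/-- If `Ad a` is the identity, right translation by `a` preserves left coordinates, hence every
left-invariant connection. -/
theorem isLocalAffineMap_of_eqOn_mul_right (Γ : E →L[ℝ] E →L[ℝ] E) {U : Set G} (hU : IsOpen U)
    {a : G} (ha : ∀ v, adInv I a v = v) {f : G → G} (hf : ∀ x ∈ U, f x = x * a) :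
    IsLocalAffineMap (leftInvariantConnection I G Γ) U f := by
  have hfa : ∀ x ∈ U, f =ᶠ[𝓝 x] (fun y ↦ y * a) := fun x hx ↦
    Filter.eventuallyEq_of_mem (hU.mem_nhds hx) hf
  have hdf : ∀ x ∈ U, MDifferentiableAt I I f x := fun x hx ↦
    (mdifferentiableAt_mul_right' a x).congr_of_eventuallyEq (hfa x hx)
  have hframe : ∀ x ∈ U, ∀ v, mfderiv I I f x (leftFrame I x v) = leftFrame I (f x) v := by
    intro x hx v
    have h1 := congrArg (fun A : E →L[ℝ] E ↦ A (leftFrame I x v))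
      ((hfa x hx).mfderiv_eq (I := I) (I' := I))
    refine h1.trans ((mfderiv_mul_right_leftFrame a x v).trans ?_)
    rw [ha]
    exact congrArg (fun q ↦ (leftFrame I q v : E)) (hf x hx).symm
  have hcoord : ∀ x ∈ U, ∀ u, leftCoord I (f x) (mfderiv I I f x u) = leftCoord I x u := by
    intro x hx u
    conv_lhs => rw [← leftFrame_leftCoord x u]
    rw [hframe x hx, leftCoord_leftFrame]
  refine ⟨⟨hU, fun x ↦ ?_, fun x hx y hy hxy ↦ ?_⟩, fun p hp Z Z' hZ hZ' hrel v ↦ ?_⟩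
  · let Φ : PartialDiffeomorph I I G G ∞ :=
      { toFun := fun y ↦ y * a
        invFun := fun y ↦ y * a⁻¹
        source := U
        target := (fun y ↦ y * a⁻¹) ⁻¹' U
        map_source' := fun y hy ↦ by simpa using hy
        map_target' := fun _ hy ↦ hy
        left_inv' := fun y _ ↦ mul_inv_cancel_right y a
        right_inv' := fun y _ ↦ inv_mul_cancel_right y a
        open_source := hU
        open_target := hU.preimage (contMDiff_mul_right (I := I) (n := ∞) (a := a⁻¹)).continuous
        contMDiffOn_toFun := (contMDiff_mul_right (a := a)).contMDiffOn
        contMDiffOn_invFun := (contMDiff_mul_right (a := a⁻¹)).contMDiffOn }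
    exact ⟨Φ, x.2, hf⟩
  · rw [hf x hx, hf y hy] at hxy
    exact mul_right_cancel hxy
  · have hco : (fun y ↦ leftCoord I (f y) (Z' (f y))) =ᶠ[𝓝 p] fun y ↦ leftCoord I y (Z y) := by
      filter_upwards [hrel, hU.mem_nhds hp] with y hy hyU
      rw [← hy, hcoord y hyU]
    have hd : mvfderiv I (fun y ↦ leftCoord I y (Z' y)) (f p) (mfderiv I I f p v) =
        mvfderiv I (fun y ↦ leftCoord I y (Z y)) p v := by
      have hZd := mdifferentiableAt_leftCoord (hZ'.mdifferentiableAt (by simp))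
      have h1 := mfderiv_comp p hZd (hdf p hp)
      have h2 := hco.mfderiv_eq (I := I) (I' := 𝓘(ℝ, E))
      exact (congrArg (fun A : E →L[ℝ] E ↦ A v) (h1.symm.trans h2))
    rw [leftInvariantConnection_apply, leftInvariantConnection_apply, hframe p hp, hd,
      hcoord p hp]
    exact congrArg (fun z ↦ leftFrame I (f p) (_ + Γ (leftCoord I p v) z)) hco.self_of_nhds.symm

end RightTranslation

section TwoStep

variable {E : Type*} [NormedAddCommGroup E] [NormedSpace ℝ E] [FiniteDimensional ℝ E]
  [CompleteSpace E]
  {H : Type*} [TopologicalSpace H] {I : ModelWithCorners ℝ E H}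
  {G : Type*} [TopologicalSpace G] [ChartedSpace H G] [Group G] [LieGroup I ∞ G]
  {g : ContMDiffRiemannianMetric I ∞ E (fun x : G ↦ TangentSpace I x)}

variable (I G) in
theorem mem_lieAlgebra_center_iff (X : GroupLieAlgebra I G) :
    X ∈ LieAlgebra.center ℝ (GroupLieAlgebra I G) ↔ ∀ u, lieBilin I G X u = 0 := by
  rw [LieModule.mem_maxTrivSubmodule]
  refine forall_congr' fun u ↦ ?_
  rw [← neg_eq_zero, lie_skew]
  rfl

/-- Orthogonal decomposition with respect to the center. -/
theorem exists_add_center_orthogonal (u : E) : ∃ z v : E, u = z + v ∧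
    (∀ w, lieBilin I G z w = 0) ∧ ∀ z', (∀ w, lieBilin I G z' w = 0) → innerOne g v z' = 0 := by
  set B : LinearMap.BilinForm ℝ E := (innerOne g).toLinearMap₁₂
  have hB : B.IsRefl := fun x y (h : innerOne g x y = 0) ↦ (innerOne_symm (g := g) y x).trans h
  set W : Submodule ℝ E := LinearMap.ker (lieBilin I G).toLinearMap
  have hdisj : Disjoint W (B.orthogonal W) := by
    refine Submodule.disjoint_def.2 fun x hx hx' ↦ ?_
    by_contra hne
    exact (innerOne_pos (g := g) x hne).ne' (hx' x hx)
  have hcompl := (LinearMap.BilinForm.isCompl_orthogonal_iff_disjoint hB).2 hdisj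
  obtain ⟨z, hz, v, hv, rfl⟩ := Submodule.mem_sup.1 (hcompl.sup_eq_top ▸ Submodule.mem_top (x := u))
  refine ⟨z, v, rfl, fun w ↦ ?_, fun z' hz' ↦ ?_⟩
  · have hz0 : lieBilin I G z = 0 := hz
    rw [hz0]; rfl
  · rw [innerOne_symm]
    exact hv z' (ContinuousLinearMap.ext hz')

/-- In a two-step nilpotent group, if `⟨w, [w, X]⟩ = 0` along all the curves `w = Ad c⁻¹ v` with
`v` orthogonal to the center, then `X` is central: the derivative of this relation at the identity is
`|[X, v]|² = 0`. -/
theorem lieBilin_eq_zero_of_adInv [I.Boundaryless]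
    (h2 : ∀ u v w, lieBilin I G u (lieBilin I G v w) = 0) {X : E} {c : ℝ → G} {ε : ℝ} (hε : 0 < ε)
    (hc0 : c 0 = 1) (hc : IsMIntegralCurveOn c (fun x : G ↦ leftFrame I x X) (Ioo (-ε) ε))
    (h : ∀ v, (∀ z, (∀ w, lieBilin I G z w = 0) → innerOne g v z = 0) → ∀ t ∈ Ioo (-ε) ε,
      innerOne g (adInv I (c t) v) (lieBilin I G (adInv I (c t) v) X) = 0) (u : E) :
    lieBilin I G X u = 0 := by
  obtain ⟨z, v, rfl, hz, hv⟩ := exists_add_center_orthogonal (I := I) (G := G) (g := g) u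
  rw [map_add, ← lieBilin_skew, hz, neg_zero, zero_add]
  have h0 : (0 : ℝ) ∈ Ioo (-ε) ε := by simp [hε]
  have hd := hasDerivAt_adInv isOpen_Ioo hc v h0
  have hL : HasDerivAt (fun t ↦ lieBilin I G (adInv I (c t) v) X)
      (lieBilin I G (-lieBilin I G X (adInv I (c 0) v)) X) 0 :=
    ((lieBilin I G).flip X).hasFDerivAt.comp_hasDerivAt 0 hd
  have hB : HasDerivAt (fun t ↦ innerOne g (adInv I (c t) v) (lieBilin I G (adInv I (c t) v) X))
      _ 0 := ((innerOne g).hasFDerivAt.comp_hasDerivAt 0 hd).clm_apply hL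
  have hzero : HasDerivAt
      (fun t ↦ innerOne g (adInv I (c t) v) (lieBilin I G (adInv I (c t) v) X)) 0 0 := by
    refine (hasDerivAt_const (0 : ℝ) (0 : ℝ)).congr_of_eventuallyEq ?_
    filter_upwards [isOpen_Ioo.mem_nhds h0] with t ht using h v hv t ht
  have key := hB.unique hzero
  have hLv : lieBilin I G v X = -lieBilin I G X v := (lieBilin_skew X v).symm
  have hLL : lieBilin I G (-lieBilin I G X v) X = 0 := by
    rw [← hLv, ← lieBilin_skew, h2, neg_zero]
  simp only [Function.comp_apply, hc0, adInv_one] at key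
  by_contra hne
  refine (innerOne_pos (g := g) _ hne).ne' ?_
  have hLL' : lieBilin I G (lieBilin I G X v) X = 0 := by
    rwa [map_neg, neg_apply, neg_eq_zero] at hLL
  simpa [hLv, hLL'] using key

/-- Vectors orthogonal to the center generate geodesic left-invariant fields. -/
theorem IsLeviCivita.cov_self_eq_zero_of_orthogonal (hg : IsLeftInvariantMetric g)
    (h2 : ∀ u v w, lieBilin I G u (lieBilin I G v w) = 0)
    {cov : CovariantDerivative I E (TangentSpace I : G → Type _)} (hcov : IsLeviCivita g cov)
    {v : E} (hv : ∀ z, (∀ w, lieBilin I G z w = 0) → innerOne g v z = 0) (x : G) :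
    cov (fun y ↦ leftFrame I y v) x (leftFrame I x v) = 0 := by
  refine (hcov.cov_self_eq_zero_iff hg x v).2 fun u ↦ hv _ fun w ↦ ?_
  rw [← lieBilin_skew, h2, neg_zero]

variable [I.Boundaryless]

/-- Affine left-invariant fields of a two-step nilpotent group are central: the flow of `X` maps the
field `v` to `Ad (c t)⁻¹ v`, so it transports `∇_v v = 0`. -/
theorem IsAffineField.lieBilin_eq_zero (hg : IsLeftInvariantMetric g)
    (h2 : ∀ u v w, lieBilin I G u (lieBilin I G v w) = 0) {X : E}
    (hX : IsAffineField g (fun x : G ↦ leftFrame I x X)) (u : E) : lieBilin I G X u = 0 := by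
  obtain ⟨cov, hcov, hflow⟩ := hX
  obtain ⟨c, ε, hε, hc0, hc⟩ := exists_oneParameter (I := I) (G := G) X
  refine lieBilin_eq_zero_of_adInv (g := g) h2 hε hc0 hc (fun v hv t ht ↦ ?_) u
  have h := (hflow univ ε _ (isLocalFlow_mul_right hε hc0 hc) t ht).2 1 (mem_univ _)
    (fun y ↦ leftFrame I y v) (fun y ↦ leftFrame I y (adInv I (c t) v))
    (contMDiff_leftField v _) (contMDiff_leftField _ _)
    (Filter.Eventually.of_forall fun x ↦ mfderiv_mul_right_leftFrame (c t) x v)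
    (leftFrame I 1 v)
  rw [hcov.cov_self_eq_zero_of_orthogonal hg h2 hv, map_zero, mfderiv_mul_right_leftFrame] at h
  exact (hcov.cov_self_eq_zero_iff hg _ _).1 h.symm X

/-- Projective left-invariant fields of a two-step nilpotent group are central: the flow of `X` maps
the geodesics tangent to `v` to integral curves of `Ad (c t)⁻¹ v`. -/
theorem IsProjectiveField.lieBilin_eq_zero (hg : IsLeftInvariantMetric g)
    (h2 : ∀ u v w, lieBilin I G u (lieBilin I G v w) = 0) {X : E}
    (hX : IsProjectiveField g (fun x : G ↦ leftFrame I x X)) (u : E) : lieBilin I G X u = 0 := by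
  obtain ⟨cov, hcov, hflow⟩ := hX
  obtain ⟨c, ε, hε, hc0, hc⟩ := exists_oneParameter (I := I) (G := G) X
  refine lieBilin_eq_zero_of_adInv (g := g) h2 hε hc0 hc (fun v hv t ht ↦ ?_) u
  obtain ⟨γ, δ, hδ, -, hγ⟩ := exists_oneParameter (I := I) (G := G) v
  have h0 : (0 : ℝ) ∈ Ioo (-δ) δ := by simp [hδ]
  have hsmooth := contMDiffOn_of_isMIntegralCurveOn (contMDiff_leftField v) isOpen_Ioo hγ
  have hgeo : IsGeodesicOn cov γ (Ioo (-δ) δ) := by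
    refine ⟨hsmooth, fun s hs ↦ ?_⟩
    rw [covDerivAlong_eq cov (Z := fun x ↦ leftFrame I x v)
      ((hsmooth.contMDiffAt (isOpen_Ioo.mem_nhds hs)).mdifferentiableAt (by simp))
      (mdifferentiableAt_leftField v _) (hasDerivAt_const s (1 : ℝ)),
      velocity_eq_of_isMIntegralCurveOn isOpen_Ioo hγ hs,
      hcov.cov_self_eq_zero_of_orthogonal hg h2 hv]
    · simp
    · filter_upwards [isOpen_Ioo.mem_nhds hs] with r hr
      rw [velocity_eq_of_isMIntegralCurveOn isOpen_Ioo hγ hr, one_smul]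
  have hrep := (hflow univ ε _ (isLocalFlow_mul_right hε hc0 hc) t ht).2 (Ioo (-δ) δ) γ isOpen_Ioo
    ordConnected_Ioo (mapsTo_univ _ _) hgeo
  obtain ⟨r, hr⟩ := exists_cov_self_eq_smul_of_isReparametrizedGeodesicOn isOpen_Ioo hrep
    (isMIntegralCurveOn_mul_right hγ (c t)) h0 (mdifferentiableAt_leftField _ _)
  set w := adInv I (c t) v
  set q : G := γ 0 * c t
  have hr' : cov (fun y ↦ leftFrame I y w) q (leftFrame I q w) = r • leftFrame I q w := hr
  -- `∇_w w` is orthogonal to `w`, so the factor `r` is trivial.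
  have hw := hcov.innerOne_leftCoord_cov_self hg q w w
  rw [hr', lieBilin_self, map_smul, leftCoord_leftFrame] at hw
  have hrw : r • w = 0 := by
    by_contra hne
    obtain ⟨hr0, hw0⟩ := smul_ne_zero_iff.1 hne
    have := innerOne_pos (g := g) w hw0
    simp [hr0, this.ne'] at hw
  refine (hcov.cov_self_eq_zero_iff hg q w).1 ?_ X
  rw [hr', ← map_smul, hrw, map_zero]

/-- Central left-invariant fields are affine: `Ad (c t)⁻¹ v` is constant along the flow. -/
theorem isAffineField_of_lieBilin_eq_zero [T2Space G] (hg : IsLeftInvariantMetric g) {X : E}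
    (hX : ∀ u, lieBilin I G X u = 0) : IsAffineField g (fun x : G ↦ leftFrame I x X) := by
  obtain ⟨Γ, hΓ⟩ := exists_isLeviCivita_leftInvariantConnection hg
  refine ⟨_, hΓ, fun U ε φ hφ t ht ↦ ?_⟩
  rcases U.eq_empty_or_nonempty with rfl | hU
  · exact isLocalAffineMap_of_eqOn_mul_right Γ isOpen_empty (a := 1)
      (fun v ↦ by rw [adInv_one]) (by simp)
  obtain ⟨c, hc0, hc, hφc⟩ := hφ.exists_eq_mul_right hU
  refine isLocalAffineMap_of_eqOn_mul_right Γ hφ.isOpen (a := c t) (fun v ↦ ?_)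
    fun x hx ↦ hφc x hx t ht
  have hder : ∀ s ∈ Ioo (-ε) ε, HasDerivAt (fun s ↦ adInv I (c s) v) 0 s := fun s hs ↦ by
    simpa [hX] using hasDerivAt_adInv isOpen_Ioo hc v hs
  have h := isOpen_Ioo.is_const_of_deriv_eq_zero isPreconnected_Ioo
    (fun s hs ↦ (hder s hs).differentiableAt.differentiableWithinAt)
    (fun s hs ↦ (hder s hs).deriv) ht (⟨by linarith [hφ.pos], hφ.pos⟩ : (0 : ℝ) ∈ Ioo (-ε) ε)
  refine h.trans ?_
  rw [hc0, adInv_one]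

end TwoStep

end GeometricFields

theorem mainTheorem2 {N : Type*} [TopologicalSpace N] [T2Space N]
    [ChartedSpace (EuclideanSpace ℝ (Fin 5)) N] [Group N] [LieGroup (𝓡 5) ∞ N]
    [SimplyConnectedSpace N]
    (g : ContMDiffRiemannianMetric (𝓡 5) ∞ (EuclideanSpace ℝ (Fin 5))
      (fun x : N ↦ TangentSpace (𝓡 5) x))
    (hg : GeometricFields.IsLeftInvariantMetric g)
    (hnil : GeometricFields.IsTwoStepNilpotent (GroupLieAlgebra (𝓡 5) N)) :
    (∀ X : GroupLieAlgebra (𝓡 5) N,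
      GeometricFields.IsProjectiveField g (mulInvariantVectorField X) →
        GeometricFields.IsAffineField g (mulInvariantVectorField X)) ∧
    (∀ X : GroupLieAlgebra (𝓡 5) N,
      GeometricFields.IsAffineField g (mulInvariantVectorField X) ↔
        X ∈ LieAlgebra.center ℝ (GroupLieAlgebra (𝓡 5) N)) := by
  open GeometricFields in
  have h2 : ∀ u v w, lieBilin (𝓡 5) N u (lieBilin (𝓡 5) N v w) = 0 := hnil.2
  refine ⟨fun X hX ↦ ?_, fun X ↦ ⟨fun hX ↦ ?_, fun hX ↦ ?_⟩⟩
  · exact isAffineField_of_lieBilin_eq_zero hg (IsProjectiveField.lieBilin_eq_zero hg h2 hX)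
  · exact (mem_lieAlgebra_center_iff (𝓡 5) N X).2 (IsAffineField.lieBilin_eq_zero hg h2 hX)
  · exact isAffineField_of_lieBilin_eq_zero hg ((mem_lieAlgebra_center_iff (𝓡 5) N X).1 hX)
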